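/- Let $n\ge 2$ and let $(M,\langle\cdot,\cdot\rangle,I,\Psi)$ be a special almost Hermitian $2n$-manifold: a smooth Riemannian $2n$-manifold with an orthogonal almost complex structure $I$ and a smooth complex volume form $\Psi=\psi_++i\psi_-$, i.e. a complex-valued $n$-form with $\Psi(IX_1,X_2,\dots,X_n)=i\,\Psi(X_1,\dots,X_n)$ and $\frac1{n!}\sum_{i_1,\dots,i_n=1}^n|\Psi(u_{i_1},\dots,u_{i_n})|^2=1$ for unitary bases $u_1,\dots,u_n$. Let $\nabla$ be the Levi-Civita connection, put $\xi_XY=-\frac12I(\nabla_XI)Y$, and let $\widetilde\nabla=\nabla+\xi$ be the minimal $\mathrm U(n)$-connection. Let $\overline\nabla$ be the minimal $\mathrm{SU}(n)$-connection, i.e. the connection for which $\langle\cdot,\cdot\rangle$, $I$ and $\Psi$ are parallel and $\overline\nabla-\nabla$ takes its values in the orthogonal complement of $\mathfrak{su}(n)$ in $\mathfrak{so}(2n)$. Then $\overline\nabla=\nabla+\eta+\xi$ with $\eta_XY=\hat\eta(X)\,IY$ for a one-form $\hat\eta$. Let $R_{X,Y}=\nabla_{[X,Y]}-[\nabla_X,\nabla_Y]$,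 and, for an orthonormal basis $e_1,\dots,e_{2n}$ of the tangent space and with summation over repeated indices, $\mathrm{Ric}(X,Y)=\langle R_{X,e_i}Y,e_i\rangle$ and $\mathrm{Ric}^*(X,Y)=\langle R_{X,e_i}IY,Ie_i\rangle$; let $d\hat\eta(X,Y)=X(\hat\eta(Y))-Y(\hat\eta(X))-\hat\eta([X,Y])$. Then for all tangent vectors $X,Y$ at a point, $$\mathrm{Ric}^*(X,Y)=n\,d\hat\eta(X,IY)-\langle\xi_Xe_i,\xi_{IY}Ie_i\rangle,$$ $$\begin{aligned}\mathrm{Ric}(X,Y)={}&n\,d\hat\eta(X,IY)-\langle\xi_Xe_i,\xi_{IY}Ie_i\rangle-2\langle(\widetilde\nabla_{e_i}\xi)_XY,e_i\rangle+2\langle(\widetilde\nabla_X\xi)_{e_i}Y,e_i\rangle\\&-2\langle\xi_{\xi_{e_i}X}Y,e_i\rangle+2\langle\xi_{\xi_Xe_i}Y,e_i\rangle.\end{aligned}$$ -/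

import Mathlib

open Bundle FiberBundle VectorField
open scoped Manifold ContDiff

noncomputable section

namespace SpecialAlmostHermitian

variable {E : Type*} [NormedAddCommGroup E] [NormedSpace ℝ E] [FiniteDimensional ℝ E]
  {M : Type*} [TopologicalSpace M] [ChartedSpace E M] [IsManifold 𝓘(ℝ, E) ∞ M]
  [RiemannianBundle (fun x : M ↦ TangentSpace 𝓘(ℝ, E) x)]
  [IsContMDiffRiemannianBundle 𝓘(ℝ, E) ∞ E (fun x : M ↦ TangentSpace 𝓘(ℝ, E) x)]

local notation "⟪" v ", " w "⟫" => inner ℝ v w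

set_option linter.unusedSectionVars false

instance (x : M) : FiniteDimensional ℝ (TangentSpace 𝓘(ℝ, E) x) :=
  inferInstanceAs (FiniteDimensional ℝ E)

instance (x : M) : CompleteSpace (TangentSpace 𝓘(ℝ, E) x) :=
  FiniteDimensional.complete ℝ _

theorem mdifferentiableAt_inner {X Y : Π x : M, TangentSpace 𝓘(ℝ, E) x} {x : M}
    (hX : MDiffAt (T% X) x) (hY : MDiffAt (T% Y) x) : MDiffAt (fun y ↦ ⟪X y, Y y⟫) x :=
  @MDifferentiableAt.inner_bundle E _ _ E _ 𝓘(ℝ, E) M _ _ E _ _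
    (fun x : M ↦ TangentSpace 𝓘(ℝ, E) x) _ inferInstance inferInstance
    _ _ E _ _ E _ 𝓘(ℝ, E) M _ _ _ _ _ _ _ hX hY

/-- The right-hand side of the Koszul formula: `2⟨∇_X Y, W⟩` at `x`. -/
def koszul (Y X W : Π x : M, TangentSpace 𝓘(ℝ, E) x) (x : M) : ℝ :=
  d% (fun y ↦ ⟪Y y, W y⟫) x (X x) + d% (fun y ↦ ⟪X y, W y⟫) x (Y x)
    - d% (fun y ↦ ⟪X y, Y y⟫) x (W x)
    + ⟪mlieBracket 𝓘(ℝ, E) X Y x, W x⟫ - ⟪mlieBracket 𝓘(ℝ, E) X W x, Y x⟫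
    - ⟪mlieBracket 𝓘(ℝ, E) Y W x, X x⟫

theorem koszul_tensorial_left {Y W : Π x : M, TangentSpace 𝓘(ℝ, E) x} {x : M}
    (hY : MDiffAt (T% Y) x) (hW : MDiffAt (T% W) x) :
    TensorialAt 𝓘(ℝ, E) E (fun X ↦ koszul Y X W x) x where
  smul {f X} hf hX := by
    simp only [koszul, mlieBracket_smul_left hf hX, Pi.smul_apply', real_inner_smul_left,
      real_inner_smul_right, mvfderiv_fun_mul hf (mdifferentiableAt_inner hX hW),
      mvfderiv_fun_mul hf (mdifferentiableAt_inner hX hY), inner_add_left]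
    simp
    ring
  add hX hX' := by
    simp only [koszul, mlieBracket_add_left hX hX', Pi.add_apply, inner_add_left,
      inner_add_right, map_add,
      mvfderiv_fun_add (mdifferentiableAt_inner hX hW) (mdifferentiableAt_inner hX' hW),
      mvfderiv_fun_add (mdifferentiableAt_inner hX hY) (mdifferentiableAt_inner hX' hY)]
    simp
    ring

theorem koszul_tensorial_right {Y X : Π x : M, TangentSpace 𝓘(ℝ, E) x} {x : M}
    (hY : MDiffAt (T% Y) x) (hX : MDiffAt (T% X) x) :
    TensorialAt 𝓘(ℝ, E) E (fun W ↦ koszul Y X W x) x where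
  smul {f W} hf hW := by
    simp only [koszul, mlieBracket_smul_right hf hW, Pi.smul_apply', real_inner_smul_left,
      real_inner_smul_right, mvfderiv_fun_mul hf (mdifferentiableAt_inner hY hW),
      mvfderiv_fun_mul hf (mdifferentiableAt_inner hX hW), inner_add_left]
    simp [real_inner_comm]
    ring
  add hW hW' := by
    simp only [koszul, mlieBracket_add_right hW hW', Pi.add_apply, inner_add_left,
      inner_add_right, map_add,
      mvfderiv_fun_add (mdifferentiableAt_inner hX hW) (mdifferentiableAt_inner hX hW'),
      mvfderiv_fun_add (mdifferentiableAt_inner hY hW) (mdifferentiableAt_inner hY hW')]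
    simp
    ring


/-- The Koszul expression, as a bilinear form in the values of `X` and `W` at `x`. -/
def koszulHom {Y : Π x : M, TangentSpace 𝓘(ℝ, E) x} {x : M} (hY : MDiffAt (T% Y) x) :
    TangentSpace 𝓘(ℝ, E) x →L[ℝ] TangentSpace 𝓘(ℝ, E) x →L[ℝ] ℝ :=
  TensorialAt.mkHom₂ (fun X W ↦ koszul Y X W x) x
    (fun _ hW ↦ koszul_tensorial_left hY hW) (fun _ hX ↦ koszul_tensorial_right hY hX)

theorem koszulHom_apply {Y X W : Π x : M, TangentSpace 𝓘(ℝ, E) x} {x : M}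
    (hY : MDiffAt (T% Y) x) (hX : MDiffAt (T% X) x) (hW : MDiffAt (T% W) x) :
    koszulHom hY (X x) (W x) = koszul Y X W x :=
  TensorialAt.mkHom₂_apply _ _ hX hW

open Classical in
/-- `leviCivitaAux Y x v = ∇_v Y`, the vector dual to half the Koszul expression. (At points where
`Y` is not differentiable, the value is irrelevant and set to `0`.) -/
def leviCivitaAux (Y : Π x : M, TangentSpace 𝓘(ℝ, E) x) (x : M) :
    TangentSpace 𝓘(ℝ, E) x →L[ℝ] TangentSpace 𝓘(ℝ, E) x :=
  if hY : MDiffAt (T% Y) x then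
    LinearMap.toContinuousLinearMap
      { toFun := fun v ↦
          (InnerProductSpace.toDual ℝ (TangentSpace 𝓘(ℝ, E) x)).symm ((2⁻¹ : ℝ) • koszulHom hY v)
        map_add' := fun v w ↦ by simp
        map_smul' := fun c v ↦ by simp [smul_comm c] }
  else 0

theorem inner_leviCivitaAux {Y X W : Π x : M, TangentSpace 𝓘(ℝ, E) x} {x : M}
    (hY : MDiffAt (T% Y) x) (hX : MDiffAt (T% X) x) (hW : MDiffAt (T% W) x) :
    ⟪leviCivitaAux Y x (X x), W x⟫ = 2⁻¹ * koszul Y X W x := by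
  rw [← koszulHom_apply hY hX hW, leviCivitaAux, dif_pos hY]
  simp [real_inner_smul_left]

theorem leviCivitaAux_ext {x : M}
    {A B : TangentSpace 𝓘(ℝ, E) x →L[ℝ] TangentSpace 𝓘(ℝ, E) x}
    (h : ∀ X W : Π x : M, TangentSpace 𝓘(ℝ, E) x, MDiffAt (T% X) x → MDiffAt (T% W) x →
      ⟪A (X x), W x⟫ = ⟪B (X x), W x⟫) : A = B := by
  ext v
  refine ext_inner_right ℝ fun w ↦ ?_
  simpa using h (extend E v) (extend E w) (mdifferentiableAt_extend ..)
    (mdifferentiableAt_extend ..)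

variable (E M) in
/-- The Levi-Civita connection `∇` of the Riemannian metric. Mathlib's argument order is
`leviCivita E M Y x v = (∇_v Y)(x)`. -/
def leviCivita : CovariantDerivative 𝓘(ℝ, E) E (fun x : M ↦ TangentSpace 𝓘(ℝ, E) x) where
  toFun := leviCivitaAux
  isCovariantDerivativeOnUniv :=
    { add := by
        intro Y Y' x hY hY' _
        refine leviCivitaAux_ext fun X W hX hW ↦ ?_
        rw [add_apply, inner_add_left, inner_leviCivitaAux hY hX hW,
          inner_leviCivitaAux hY' hX hW,
          inner_leviCivitaAux (mdifferentiableAt_add_section hY hY') hX hW]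
        simp only [koszul, mlieBracket_add_left hY hY', mlieBracket_add_right hY hY',
          Pi.add_apply, inner_add_left, inner_add_right, map_add,
          mvfderiv_fun_add (mdifferentiableAt_inner hY hW) (mdifferentiableAt_inner hY' hW),
          mvfderiv_fun_add (mdifferentiableAt_inner hX hY) (mdifferentiableAt_inner hX hY')]
        simp
        ring
      leibniz := by
        intro Y f x hY hf _
        refine leviCivitaAux_ext fun X W hX hW ↦ ?_
        have hs := inner_leviCivitaAux (hf.smul_section hY) hX hW
        have h0 := inner_leviCivitaAux hY hX hW
        refine hs.trans ?_
        simp only [add_apply, inner_add_left, smul_apply,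
          real_inner_smul_left, ContinuousLinearMap.smulRight_apply, h0]
        simp only [koszul, mlieBracket_smul_left hf hY, mlieBracket_smul_right hf hY,
          Pi.smul_apply', real_inner_smul_left,
          real_inner_smul_right, mvfderiv_fun_mul hf (mdifferentiableAt_inner hY hW),
          mvfderiv_fun_mul hf (mdifferentiableAt_inner hX hY), inner_add_left]
        simp [real_inner_comm]
        ring }

/-- The Levi-Civita connection is torsion-free. -/
theorem leviCivita_torsion {X Y : Π x : M, TangentSpace 𝓘(ℝ, E) x} {x : M}
    (hX : MDiffAt (T% X) x) (hY : MDiffAt (T% Y) x) :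
    leviCivita E M Y x (X x) - leviCivita E M X x (Y x) = mlieBracket 𝓘(ℝ, E) X Y x := by
  refine ext_inner_right ℝ fun w ↦ ?_
  have hW : MDiffAt (T% (extend E w)) x := mdifferentiableAt_extend ..
  have h1 := inner_leviCivitaAux hY hX hW
  have h2 := inner_leviCivitaAux hX hY hW
  rw [extend_apply_self] at h1 h2
  rw [inner_sub_left]
  refine (congrArg₂ _ h1 h2).trans ?_
  have e : mlieBracket 𝓘(ℝ, E) Y X x = - mlieBracket 𝓘(ℝ, E) X Y x :=
    mlieBracket_swap_apply
  have e2 : (fun y ↦ ⟪Y y, X y⟫) = fun y ↦ ⟪X y, Y y⟫ := by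
    ext y; rw [real_inner_comm]
  simp [koszul, e, e2]
  ring

/-- The Levi-Civita connection is metric. -/
theorem leviCivita_metric {X Y : Π x : M, TangentSpace 𝓘(ℝ, E) x} {x : M}
    (hX : MDiffAt (T% X) x) (hY : MDiffAt (T% Y) x) (v : TangentSpace 𝓘(ℝ, E) x) :
    d% (fun y ↦ ⟪X y, Y y⟫) x v =
      ⟪leviCivita E M X x v, Y x⟫ + ⟪X x, leviCivita E M Y x v⟫ := by
  have hV : MDiffAt (T% (extend E v)) x := mdifferentiableAt_extend ..
  have h1 := inner_leviCivitaAux hX hV hY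
  have h2 := inner_leviCivitaAux hY hV hX
  rw [extend_apply_self] at h1 h2
  rw [real_inner_comm _ (X x)]
  refine Eq.trans ?_ (congrArg₂ _ h1 h2).symm
  have e : mlieBracket 𝓘(ℝ, E) Y X x = - mlieBracket 𝓘(ℝ, E) X Y x :=
    mlieBracket_swap_apply
  have e2 (A B : Π x : M, TangentSpace 𝓘(ℝ, E) x) :
      (fun y ↦ ⟪A y, B y⟫) = fun y ↦ ⟪B y, A y⟫ := by
    ext y; rw [real_inner_comm]
  simp [koszul, e, e2 Y X]
  ring

/-! ### Curvature

Tensors are evaluated at a point `x` on tangent vectors at `x`, by extending the tangent vectors to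
vector fields that are smooth near `x`; the result does not depend on the extension. -/

/-- The curvature `R_{X,Y} Z = ∇_{[X,Y]} Z - ∇_X ∇_Y Z + ∇_Y ∇_X Z` on vector fields. -/
def curvatureField (X Y Z : Π x : M, TangentSpace 𝓘(ℝ, E) x) (x : M) : TangentSpace 𝓘(ℝ, E) x :=
  leviCivita E M Z x (mlieBracket 𝓘(ℝ, E) X Y x)
    - leviCivita E M (fun y ↦ leviCivita E M Z y (Y y)) x (X x)
    + leviCivita E M (fun y ↦ leviCivita E M Z y (X y)) x (Y x)

/-- The curvature tensor `R_{X,Y} Z` on tangent vectors at `x`. -/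
def curvature (x : M) (X Y Z : TangentSpace 𝓘(ℝ, E) x) : TangentSpace 𝓘(ℝ, E) x :=
  curvatureField (extend E X) (extend E Y) (extend E Z) x

/-- The Ricci curvature `Ric(X,Y) = ∑ i, ⟨R_{X,e_i} Y, e_i⟩`, for an orthonormal basis `e`. -/
def ricci {ι : Type*} [Fintype ι] {x : M} (e : OrthonormalBasis ι ℝ (TangentSpace 𝓘(ℝ, E) x))
    (X Y : TangentSpace 𝓘(ℝ, E) x) : ℝ :=
  ∑ i, ⟪curvature x X (e i) Y, e i⟫

/-- The exterior derivative of a one-form,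
`dθ(X,Y) = X(θ(Y)) - Y(θ(X)) - θ([X,Y])`, on tangent vectors at `x`. -/
def extDerivOneForm (θ : Π x : M, TangentSpace 𝓘(ℝ, E) x → ℝ) (x : M)
    (X Y : TangentSpace 𝓘(ℝ, E) x) : ℝ :=
  d% (fun y ↦ θ y (extend E Y y)) x X - d% (fun y ↦ θ y (extend E X y)) x Y
    - θ x (mlieBracket 𝓘(ℝ, E) (extend E X) (extend E Y) x)

/-! ### Almost Hermitian structures -/

variable (E M) in
/-- An orthogonal almost complex structure `J` (a smooth field of endomorphisms) on the Riemannian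
manifold `M`, which together with the metric makes `M` an almost Hermitian manifold. -/
structure AlmostHermitian where
  /-- the almost complex structure -/
  J : Π x : M, TangentSpace 𝓘(ℝ, E) x →L[ℝ] TangentSpace 𝓘(ℝ, E) x
  smooth_J : ContMDiff 𝓘(ℝ, E) (𝓘(ℝ, E).prod 𝓘(ℝ, E →L[ℝ] E)) ∞
    (fun x ↦ TotalSpace.mk' (E →L[ℝ] E)
      (E := fun x : M ↦ TangentSpace 𝓘(ℝ, E) x →L[ℝ] TangentSpace 𝓘(ℝ, E) x) x (J x))
  J_J : ∀ (x : M) (v : TangentSpace 𝓘(ℝ, E) x), J x (J x v) = -v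
  inner_J_J : ∀ (x : M) (v w : TangentSpace 𝓘(ℝ, E) x), ⟪J x v, J x w⟫ = ⟪v, w⟫

namespace AlmostHermitian

variable (S : AlmostHermitian E M)

theorem mdifferentiableAt_J {Y : Π x : M, TangentSpace 𝓘(ℝ, E) x} {x : M}
    (hY : MDiffAt (T% Y) x) : MDiffAt (T% (fun y ↦ S.J y (Y y))) x :=
  (S.smooth_J.mdifferentiable (by simp) x).clm_bundle_apply hY

/-- `Y ↦ (X ↦ -½ J ((∇_X J) Y))` on vector fields `Y`, at the point `x`. -/
def torsionAux (Y : Π x : M, TangentSpace 𝓘(ℝ, E) x) (x : M) :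
    TangentSpace 𝓘(ℝ, E) x →L[ℝ] TangentSpace 𝓘(ℝ, E) x :=
  (-(1 / 2) : ℝ) • (S.J x ∘L
    (leviCivita E M (fun y ↦ S.J y (Y y)) x - S.J x ∘L leviCivita E M Y x))

theorem torsionAux_tensorial (x : M) :
    TensorialAt 𝓘(ℝ, E) E (fun Y ↦ S.torsionAux Y x) x where
  smul {f Y} hf hY := by
    have h1 := (leviCivita E M).isCovariantDerivativeOnUniv.leibniz (S.mdifferentiableAt_J hY) hf
    have h2 := (leviCivita E M).isCovariantDerivativeOnUniv.leibniz hY hf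
    have e : (fun y ↦ S.J y ((f • Y) y)) = f • (fun y ↦ S.J y (Y y)) := by
      ext y
      simp
    ext v
    replace h1 := congrArg (fun A ↦ A v) h1
    replace h2 := congrArg (fun A ↦ A v) h2
    simp only [add_apply, smul_apply, ContinuousLinearMap.smulRight_apply] at h1 h2
    simp only [torsionAux, e, smul_apply, ContinuousLinearMap.comp_apply, sub_apply]
    erw [h1, h2]
    simp only [map_add, map_smul, map_sub, S.J_J]
    module
  add {Y Y'} hY hY' := by
    have h1 := (leviCivita E M).isCovariantDerivativeOnUniv.add
      (S.mdifferentiableAt_J hY) (S.mdifferentiableAt_J hY')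
    have h2 := (leviCivita E M).isCovariantDerivativeOnUniv.add hY hY'
    have e : (fun y ↦ S.J y ((Y + Y') y)) =
        (fun y ↦ S.J y (Y y)) + (fun y ↦ S.J y (Y' y)) := by
      ext y
      simp
    ext v
    replace h1 := congrArg (fun A ↦ A v) h1
    replace h2 := congrArg (fun A ↦ A v) h2
    simp only [add_apply] at h1 h2
    simp only [torsionAux, e, smul_apply, add_apply, ContinuousLinearMap.comp_apply, sub_apply]
    erw [h1, h2]
    simp only [map_add, map_sub]
    module

/-- The intrinsic `U(n)`-torsion as a tensor, `S.torsion x Y X = ξ_X Y = -½ J ((∇_X J) Y)`. -/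
def torsion (x : M) : TangentSpace 𝓘(ℝ, E) x →L[ℝ]
    TangentSpace 𝓘(ℝ, E) x →L[ℝ] TangentSpace 𝓘(ℝ, E) x :=
  TensorialAt.mkHom (fun Y ↦ S.torsionAux Y x) x (S.torsionAux_tensorial x)

/-- The intrinsic `U(n)`-torsion `ξ_X Y = -½ J ((∇_X J) Y)`, with the arguments in the usual
order: `S.xi x X Y = ξ_X Y`. -/
def xi (x : M) (X Y : TangentSpace 𝓘(ℝ, E) x) : TangentSpace 𝓘(ℝ, E) x := S.torsion x Y X

/-- The minimal `U(n)`-connection `∇ + ξ`. -/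
def minimalUConnection :
    CovariantDerivative 𝓘(ℝ, E) E (fun x : M ↦ TangentSpace 𝓘(ℝ, E) x) :=
  (leviCivita E M).addOneForm S.torsion

/-- `S.nablaXi x X Y Z = ((∇ᵁ_X ξ)_Y Z)(x)`, the covariant derivative of `ξ` with respect to the
minimal `U(n)`-connection `∇ᵁ`:
`(∇ᵁ_X ξ)_Y Z = ∇ᵁ_X (ξ_Y Z) - ξ_{∇ᵁ_X Y} Z - ξ_Y (∇ᵁ_X Z)`. -/
def nablaXi (x : M) (X Y Z : TangentSpace 𝓘(ℝ, E) x) : TangentSpace 𝓘(ℝ, E) x :=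
  S.minimalUConnection (fun y ↦ S.xi y (extend E Y y) (extend E Z y)) x X
    - S.xi x (S.minimalUConnection (extend E Y) x X) Z
    - S.xi x Y (S.minimalUConnection (extend E Z) x X)

/-- The `*`-Ricci curvature `Ric*(X,Y) = ∑ i, ⟨R_{X,e_i} JY, J e_i⟩`. -/
def ricciStar {ι : Type*} [Fintype ι] {x : M}
    (e : OrthonormalBasis ι ℝ (TangentSpace 𝓘(ℝ, E) x)) (X Y : TangentSpace 𝓘(ℝ, E) x) : ℝ :=
  ∑ i, ⟪curvature x X (e i) (S.J x Y), S.J x (e i)⟫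

/-- The Hermitian product `⟨v, w⟩ + i ω(v, w)`, where `ω(v, w) = ⟨v, J w⟩`. It is complex linear in
the first argument. -/
def hermitian (x : M) (v w : TangentSpace 𝓘(ℝ, E) x) : ℂ :=
  (⟪v, w⟫ : ℝ) + Complex.I * (⟪v, S.J x w⟫ : ℝ)

/-- The Lie algebra `su(n)` at `x`: the endomorphisms of the tangent space that are skew-symmetric,
complex linear, and of complex trace `½ (tr B - i tr (J B))` zero. -/
def suAlgebra (x : M) : Set (TangentSpace 𝓘(ℝ, E) x →L[ℝ] TangentSpace 𝓘(ℝ, E) x) :=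
  {B | (∀ v w, ⟪B v, w⟫ = -⟪v, B w⟫) ∧ (∀ v, B (S.J x v) = S.J x (B v)) ∧
    LinearMap.trace ℝ (TangentSpace 𝓘(ℝ, E) x) B.toLinearMap = 0 ∧
    LinearMap.trace ℝ (TangentSpace 𝓘(ℝ, E) x) (S.J x ∘L B).toLinearMap = 0}

/-- The orthogonal complement of `su(n)` in `so(2n)`, for the inner product `-tr (A B)`. -/
def suPerp (x : M) : Set (TangentSpace 𝓘(ℝ, E) x →L[ℝ] TangentSpace 𝓘(ℝ, E) x) :=
  {A | (∀ v w, ⟪A v, w⟫ = -⟪v, A w⟫) ∧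
    ∀ B ∈ S.suAlgebra x, LinearMap.trace ℝ (TangentSpace 𝓘(ℝ, E) x) (A ∘L B).toLinearMap = 0}

end AlmostHermitian

/-! ### Special almost Hermitian structures -/

variable (E M) in
/-- A special almost Hermitian structure (`SU(n)`-structure) on the Riemannian manifold `M`:
an orthogonal almost complex structure `J` and a smooth complex volume form `Ψ` (an `n`-form that is
complex linear for `J`) with `⟨⟨Ψ, Ψ⟩⟩ = 1`. -/
structure SpecialStructure (n : ℕ) extends AlmostHermitian E M where
  /-- the complex volume form `Ψ = ψ₊ + i ψ₋` -/
  Ψ : Π x : M, TangentSpace 𝓘(ℝ, E) x [⋀^Fin n]→L[ℝ] ℂ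
  /-- `Ψ` is smooth: it takes smooth vector fields to smooth functions, locally. -/
  smooth_Ψ : ∀ (x : M) (Y : Fin n → Π x : M, TangentSpace 𝓘(ℝ, E) x),
    (∀ i, CMDiffAt ∞ (T% (Y i)) x) →
    ContMDiffAt 𝓘(ℝ, E) 𝓘(ℝ, ℂ) ∞ (fun y ↦ Ψ y (fun i ↦ Y i y)) x
  Ψ_J : ∀ (x : M) (v : Fin n → TangentSpace 𝓘(ℝ, E) x) (i : Fin n),
    Ψ x (Function.update v i (J x (v i))) = Complex.I * Ψ x v
  /-- `⟨⟨Ψ, Ψ⟩⟩ = (1/n!) ∑ |Ψ(u_{k 1}, …, u_{k n})|² = 1` for unitary bases `u`. -/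
  norm_Ψ : ∀ (x : M) (u : Fin n → TangentSpace 𝓘(ℝ, E) x),
    (∀ i j, toAlmostHermitian.hermitian x (u i) (u j) = if i = j then 1 else 0) →
    ((n.factorial : ℝ))⁻¹ * ∑ k : Fin n → Fin n, ‖Ψ x (fun i ↦ u (k i))‖ ^ 2 = 1

namespace SpecialStructure

variable {n : ℕ} (S : SpecialStructure E M n)

/-- The difference `A = D - ∇` of a connection and the Levi-Civita connection,
`connectionDifference D x X Y = A_X Y`. -/
def connectionDifference
    (D : CovariantDerivative 𝓘(ℝ, E) E (fun x : M ↦ TangentSpace 𝓘(ℝ, E) x))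
    (x : M) (X : TangentSpace 𝓘(ℝ, E) x) : TangentSpace 𝓘(ℝ, E) x →L[ℝ] TangentSpace 𝓘(ℝ, E) x :=
  (ContinuousLinearMap.apply ℝ (TangentSpace 𝓘(ℝ, E) x) X) ∘L
    (D.difference (leviCivita E M) x)

/-- `D` is the minimal `SU(n)`-connection: the metric, `J` and `Ψ` are `D`-parallel, and `D - ∇`
takes its values in the orthogonal complement of `su(n)` in `so(2n)`. -/
structure IsMinimalSUConnection
    (D : CovariantDerivative 𝓘(ℝ, E) E (fun x : M ↦ TangentSpace 𝓘(ℝ, E) x)) : Prop where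
  metric : ∀ (x : M) (Y Z : Π x : M, TangentSpace 𝓘(ℝ, E) x),
    MDiffAt (T% Y) x → MDiffAt (T% Z) x → ∀ v : TangentSpace 𝓘(ℝ, E) x,
    d% (fun y ↦ ⟪Y y, Z y⟫) x v = ⟪D Y x v, Z x⟫ + ⟪Y x, D Z x v⟫
  parallel_J : ∀ (x : M) (Y : Π x : M, TangentSpace 𝓘(ℝ, E) x),
    MDiffAt (T% Y) x → ∀ v : TangentSpace 𝓘(ℝ, E) x,
    D (fun y ↦ S.J y (Y y)) x v = S.J x (D Y x v)
  parallel_Ψ : ∀ (x : M) (Y : Fin n → Π x : M, TangentSpace 𝓘(ℝ, E) x),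
    (∀ i, MDiffAt (T% (Y i)) x) → ∀ v : TangentSpace 𝓘(ℝ, E) x,
    d% (fun y ↦ S.Ψ y (fun i ↦ Y i y)) x v =
      ∑ i, S.Ψ x (Function.update (fun j ↦ Y j x) i (D (Y i) x v))
  mem_suPerp : ∀ (x : M) (X : TangentSpace 𝓘(ℝ, E) x),
    connectionDifference D x X ∈ S.suPerp x

/-- The part `η = D - ∇ - ξ` of the intrinsic `SU(n)`-torsion, `S.eta D x X Y = η_X Y`, where `D` is
the minimal `SU(n)`-connection. -/
def eta (D : CovariantDerivative 𝓘(ℝ, E) E (fun x : M ↦ TangentSpace 𝓘(ℝ, E) x))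
    (x : M) (X : TangentSpace 𝓘(ℝ, E) x) : TangentSpace 𝓘(ℝ, E) x →L[ℝ] TangentSpace 𝓘(ℝ, E) x :=
  connectionDifference D x X -
    (ContinuousLinearMap.apply ℝ (TangentSpace 𝓘(ℝ, E) x) X) ∘L (S.torsion x)

/-- The one-form `η̂` with `η_X Y = η̂(X) J Y`, that is, `η̂(X) = -(1/2n) tr (J η_X)`. -/
def etaHat (D : CovariantDerivative 𝓘(ℝ, E) E (fun x : M ↦ TangentSpace 𝓘(ℝ, E) x))
    (x : M) (X : TangentSpace 𝓘(ℝ, E) x) : ℝ :=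
  -(1 / (2 * n)) *
    LinearMap.trace ℝ (TangentSpace 𝓘(ℝ, E) x) (S.J x ∘L S.eta D x X).toLinearMap

end SpecialStructure

end SpecialAlmostHermitian

end

noncomputable section

namespace SpecialAlmostHermitian

variable {E : Type*} [NormedAddCommGroup E] [NormedSpace ℝ E] [FiniteDimensional ℝ E]
  {M : Type*} [TopologicalSpace M] [ChartedSpace E M] [IsManifold 𝓘(ℝ, E) ∞ M]
  [RiemannianBundle (fun x : M ↦ TangentSpace 𝓘(ℝ, E) x)]
  [IsContMDiffRiemannianBundle 𝓘(ℝ, E) ∞ E (fun x : M ↦ TangentSpace 𝓘(ℝ, E) x)]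

local notation "⟪" v ", " w "⟫" => inner ℝ v w

set_option linter.unusedSectionVars false

open Filter Topology

/-! Write `∇ᵁ = ∇ + ξ`. Torsion-freeness of `∇` gives `R_{X,Y} = Rᵁ_{X,Y} + (∇ᵁ_X ξ)_Y - (∇ᵁ_Y ξ)_X
+ ξ_{ξ_X Y} - ξ_{ξ_Y X} - [ξ_X, ξ_Y]` (`curvature_eq`). Since `∇ᵁ J = 0` and every `ξ_X`
anticommutes with `J`, the terms `Rᵁ` and `[ξ_X, ξ_Y]` commute with `J`, while the other four
anticommute with it. Both formulas come from this splitting.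

In `Ric - Ric*` the commuting part cancels and the anticommuting part doubles
(`ricci_sub_ricciStar`); this is the difference of the two claimed formulas.

For `Ric*`, the Bianchi identity and pair symmetry give `2 Ric*(X,Y) = ∑ ⟨R_{X,JY} e_i, J e_i⟩`
(`two_mul_ricciStar`). In this trace the anticommuting part vanishes and the commutator contributes
the quadratic term in `ξ` (`sum_inner_curvature_J`). The trace of `Rᵁ` remains. As `η_X = η̂(X) J`
(`eta_eq`), the curvature of the `SU(n)`-connection is `Rᵁ - dη̂ J` (`curvatureOf_eq`). It
annihilates the parallel form `Ψ`, so its complex trace is zero, and the trace of `Rᵁ` against `J`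
is `2n dη̂` (`sum_inner_curvatureU`).

The connection `D` is only a covariant derivative with algebraic properties, so second derivatives
need its smoothness. That follows from the smoothness of `Ψ`, which determines `η̂`
(`smoothFunNear_etaHat`). -/

/-- The vector field `X` is smooth in a neighbourhood of `x`. -/
def SmoothNear (X : Π x : M, TangentSpace 𝓘(ℝ, E) x) (x : M) : Prop :=
  ∀ᶠ y in 𝓝 x, CMDiffAt ∞ (T% X) y

/-- The function `f` is smooth in a neighbourhood of `x`. -/
def SmoothFunNear {F : Type*} [NormedAddCommGroup F] [NormedSpace ℝ F] (f : M → F) (x : M) : Prop :=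
  ∀ᶠ y in 𝓝 x, ContMDiffAt 𝓘(ℝ, E) 𝓘(ℝ, F) ∞ f y

theorem isManifold_minSmoothness_three : IsManifold 𝓘(ℝ, E) (minSmoothness ℝ 3) M :=
  IsManifold.of_le (n := ∞) (by simpa using ENat.LEInfty.out)

attribute [local instance] isManifold_minSmoothness_three

/-! ### Calculus of locally smooth vector fields and functions. -/

section Smooth

variable {X Y Z W : Π x : M, TangentSpace 𝓘(ℝ, E) x} {x : M}
  {F : Type*} [NormedAddCommGroup F] [NormedSpace ℝ F] {f g : M → F} {a b : M → ℝ}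

theorem SmoothNear.contMDiffAt (h : SmoothNear X x) : CMDiffAt ∞ (T% X) x := h.self_of_nhds

theorem SmoothNear.mdifferentiableAt (h : SmoothNear X x) : MDiffAt (T% X) x :=
  h.contMDiffAt.mdifferentiableAt (by simp)

theorem SmoothFunNear.contMDiffAt (h : SmoothFunNear (E := E) f x) :
    ContMDiffAt 𝓘(ℝ, E) 𝓘(ℝ, F) ∞ f x := h.self_of_nhds

theorem SmoothFunNear.mdifferentiableAt (h : SmoothFunNear (E := E) f x) :
    MDifferentiableAt 𝓘(ℝ, E) 𝓘(ℝ, F) f x :=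
  h.contMDiffAt.mdifferentiableAt (by simp)

theorem SmoothNear.congr (h : SmoothNear X x) (e : ∀ᶠ y in 𝓝 x, X y = Y y) : SmoothNear Y x := by
  filter_upwards [h, eventually_eventually_nhds.2 e] with y hy he
  exact hy.congr_of_eventuallyEq (he.mono fun z hz ↦ by simp [hz])

theorem SmoothFunNear.congr (h : SmoothFunNear (E := E) f x) (e : ∀ᶠ y in 𝓝 x, f y = g y) :
    SmoothFunNear (E := E) g x := by
  filter_upwards [h, eventually_eventually_nhds.2 e] with y hy he
  exact hy.congr_of_eventuallyEq (he.mono fun z hz ↦ hz.symm)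

theorem smoothNear_extend (v : TangentSpace 𝓘(ℝ, E) x) : SmoothNear (extend E v) x := by
  obtain ⟨s, hs, h⟩ := exists_contMDiffOn_extend (I := 𝓘(ℝ, E)) (k := ∞) E v
  filter_upwards [eventually_mem_nhds_iff.2 hs] with y hy using h.contMDiffAt hy

theorem SmoothNear.add (hX : SmoothNear X x) (hY : SmoothNear Y x) :
    SmoothNear (fun y ↦ X y + Y y) x := by
  filter_upwards [hX, hY] with y h1 h2 using h1.add_section h2

theorem SmoothNear.sub (hX : SmoothNear X x) (hY : SmoothNear Y x) :
    SmoothNear (fun y ↦ X y - Y y) x := by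
  filter_upwards [hX, hY] with y h1 h2 using h1.sub_section h2

theorem SmoothNear.smul (ha : SmoothFunNear (E := E) a x) (hX : SmoothNear X x) :
    SmoothNear (fun y ↦ a y • X y) x := by
  filter_upwards [ha, hX] with y h1 h2 using h1.smul_section h2

theorem SmoothNear.const_smul (c : ℝ) (hX : SmoothNear X x) :
    SmoothNear (fun y ↦ c • X y) x := by
  filter_upwards [hX] with y h2 using h2.const_smul_section (a := c)

theorem SmoothNear.inner (hX : SmoothNear X x) (hY : SmoothNear Y x) :
    SmoothFunNear (E := E) (fun y ↦ ⟪X y, Y y⟫) x := by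
  filter_upwards [hX, hY] with y h1 h2
  exact @ContMDiffAt.inner_bundle E _ _ E _ 𝓘(ℝ, E) ∞ M _ _ E _ _
    (fun x : M ↦ TangentSpace 𝓘(ℝ, E) x) _ inferInstance inferInstance
    _ _ E _ _ E _ 𝓘(ℝ, E) M _ _ _ _ _ _ _ h1 h2

theorem SmoothNear.mlieBracket (hX : SmoothNear X x) (hY : SmoothNear Y x) :
    SmoothNear (mlieBracket 𝓘(ℝ, E) X Y) x := by
  filter_upwards [hX, hY] with y h1 h2
  have : IsManifold 𝓘(ℝ, E) ((⊤ : ℕ∞) + 1 : WithTop ℕ∞) M := by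
    simpa using (inferInstance : IsManifold 𝓘(ℝ, E) ∞ M)
  exact ContMDiffAt.mlieBracket_vectorField (m := ⊤) (n := ⊤) h1 h2 (by simp)

theorem SmoothFunNear.add (hf : SmoothFunNear (E := E) f x) (hg : SmoothFunNear (E := E) g x) :
    SmoothFunNear (E := E) (fun y ↦ f y + g y) x := by
  filter_upwards [hf, hg] with y h1 h2 using h1.add h2

theorem SmoothFunNear.sub (hf : SmoothFunNear (E := E) f x) (hg : SmoothFunNear (E := E) g x) :
    SmoothFunNear (E := E) (fun y ↦ f y - g y) x := by
  filter_upwards [hf, hg] with y h1 h2 using h1.sub h2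

theorem SmoothFunNear.const_smul (c : ℝ) (hf : SmoothFunNear (E := E) f x) :
    SmoothFunNear (E := E) (fun y ↦ c • f y) x := by
  filter_upwards [hf] with y h1 using (contMDiffAt_const (I' := 𝓘(ℝ, ℝ)) (c := c)).smul h1

theorem SmoothFunNear.div (ha : SmoothFunNear (E := E) a x) (hb : SmoothFunNear (E := E) b x)
    (h0 : b x ≠ 0) : SmoothFunNear (E := E) (fun y ↦ a y / b y) x := by
  filter_upwards [ha, hb, hb.contMDiffAt.continuousAt.eventually_ne h0] with y h1 h2 h3
    using h1.div₀ h2 h3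

/-- The derivative of a smooth function along a smooth vector field is smooth. -/
theorem SmoothFunNear.deriv [Nontrivial E] (ha : SmoothFunNear (E := E) a x)
    (hX : SmoothNear X x) : SmoothFunNear (E := E) (fun y ↦ d% a y (X y)) x := by
  have : Nontrivial (TangentSpace 𝓘(ℝ, E) x) := inferInstanceAs (Nontrivial E)
  obtain ⟨v, hv⟩ := exists_ne (0 : TangentSpace 𝓘(ℝ, E) x)
  set Z : Π y : M, TangentSpace 𝓘(ℝ, E) y := extend E v
  have hZ : SmoothNear Z x := smoothNear_extend _
  have hZx : ⟪Z x, Z x⟫ ≠ 0 := by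
    simp only [Z, extend_apply_self]
    exact inner_self_ne_zero.2 hv
  -- `X(a)` is recovered from brackets: `[X, aZ] - a[X, Z] = X(a) Z`, and pairing with the
  -- nonvanishing `Z` isolates the coefficient.
  have h1 := ((hX.mlieBracket (hZ.smul ha)).sub ((hX.mlieBracket hZ).smul ha)).inner hZ
  have h2 := h1.div (hZ.inner hZ) hZx
  refine h2.congr ?_
  filter_upwards [ha, hZ, (hZ.inner hZ).contMDiffAt.continuousAt.eventually_ne hZx] with y h3 h4 h5
  have := mlieBracket_smul_right (V := X) (h3.mdifferentiableAt (by simp))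
    (h4.mdifferentiableAt (by simp))
  change ⟪VectorField.mlieBracket 𝓘(ℝ, E) X (a • Z) y - _, _⟫ / _ = _
  rw [this, add_sub_cancel_right, real_inner_smul_left, mul_div_cancel_right₀ _ h5]

/-- The Lie bracket of vector fields acts on functions as the commutator of derivations. -/
theorem mvfderiv_mlieBracket [Nontrivial E] (ha : SmoothFunNear (E := E) a x)
    (hX : SmoothNear X x) (hY : SmoothNear Y x) :
    d% a x (mlieBracket 𝓘(ℝ, E) X Y x) =
      d% (fun y ↦ d% a y (Y y)) x (X x) - d% (fun y ↦ d% a y (X y)) x (Y x) := by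
  have : Nontrivial (TangentSpace 𝓘(ℝ, E) x) := inferInstanceAs (Nontrivial E)
  obtain ⟨v, hv⟩ := exists_ne (0 : TangentSpace 𝓘(ℝ, E) x)
  set Z : Π y : M, TangentSpace 𝓘(ℝ, E) y := extend E v
  have hZ : SmoothNear Z x := smoothNear_extend _
  have hm : ∀ {V : Π y : M, TangentSpace 𝓘(ℝ, E) y}, SmoothNear V x →
      CMDiffAt (minSmoothness ℝ 2) (T% V) x := fun h ↦ h.contMDiffAt.of_le (by simpa using ENat.LEInfty.out)
  have key : ∀ {V : Π y : M, TangentSpace 𝓘(ℝ, E) y}, SmoothNear V x →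
      ∀ᶠ y in 𝓝 x, mlieBracket 𝓘(ℝ, E) V (a • Z) y =
        ((fun y ↦ d% a y (V y)) • Z + a • mlieBracket 𝓘(ℝ, E) V Z) y := fun {V} hV ↦ by
    filter_upwards [ha, hZ] with y h3 h4
    exact mlieBracket_smul_right (V := V) (h3.mdifferentiableAt (by simp))
      (h4.mdifferentiableAt (by simp))
  have key2 : ∀ {V U : Π y : M, TangentSpace 𝓘(ℝ, E) y}, SmoothNear V x → SmoothNear U x →
      mlieBracket 𝓘(ℝ, E) V (mlieBracket 𝓘(ℝ, E) U (a • Z)) x =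
        d% (fun y ↦ d% a y (U y)) x (V x) • Z x + d% a x (U x) • mlieBracket 𝓘(ℝ, E) V Z x
        + (d% a x (V x) • mlieBracket 𝓘(ℝ, E) U Z x
          + a x • mlieBracket 𝓘(ℝ, E) V (mlieBracket 𝓘(ℝ, E) U Z) x) := fun {V U} hV hU ↦ by
    rw [EventuallyEq.mlieBracket_vectorField_eq (EventuallyEq.refl _ V) (key hU)]
    rw [mlieBracket_add_right, mlieBracket_smul_right, mlieBracket_smul_right]
    · exact ha.mdifferentiableAt
    · exact (hU.mlieBracket hZ).mdifferentiableAt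
    · exact (ha.deriv hU).mdifferentiableAt
    · exact hZ.mdifferentiableAt
    · exact (hZ.smul (ha.deriv hU)).mdifferentiableAt
    · exact ((hU.mlieBracket hZ).smul ha).mdifferentiableAt
  -- The Jacobi identity for `X, Y, aZ`, reduced by the one for `X, Y, Z`: the first-order terms in
  -- `a` times brackets cancel, and the coefficient of `Z` is the claim.
  have j1 := leibniz_identity_mlieBracket_apply (hm hX) (hm hY) (hm (hZ.smul ha))
  have j2 := leibniz_identity_mlieBracket_apply (hm hX) (hm hY) (hm hZ)
  have k1 := (key (hX.mlieBracket hY)).self_of_nhds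
  change mlieBracket 𝓘(ℝ, E) X (mlieBracket 𝓘(ℝ, E) Y (a • Z)) x
    = mlieBracket 𝓘(ℝ, E) (mlieBracket 𝓘(ℝ, E) X Y) (a • Z) x
      + mlieBracket 𝓘(ℝ, E) Y (mlieBracket 𝓘(ℝ, E) X (a • Z)) x at j1
  rw [key2 hX hY, key2 hY hX, k1, j2] at j1
  simp only [Pi.add_apply, Pi.smul_apply'] at j1
  have hZx : Z x ≠ 0 := by simpa only [Z, extend_apply_self] using hv
  refine smul_left_injective ℝ hZx ?_
  simp only
  rw [sub_smul, eq_sub_iff_add_eq, ← sub_eq_zero]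
  rw [← sub_eq_zero] at j1
  rw [← neg_eq_zero, ← j1]
  module

end Smooth

/-! ### Smoothness tested by inner products, and smoothness of the Levi-Civita connection. -/

section Musical

variable {X Y Z W : Π x : M, TangentSpace 𝓘(ℝ, E) x} {x : M}

/-- A map into the continuous linear maps out of a finite-dimensional space is smooth if it is
smooth after evaluation on every vector. -/
theorem contMDiffAt_clm_of_apply {F : Type*} [NormedAddCommGroup F] [NormedSpace ℝ F]
    {f : M → E →L[ℝ] F} (h : ∀ v, ContMDiffAt 𝓘(ℝ, E) 𝓘(ℝ, F) ∞ (fun y ↦ f y v) x) :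
    ContMDiffAt 𝓘(ℝ, E) 𝓘(ℝ, E →L[ℝ] F) ∞ f x := by
  let e₁ := ContinuousLinearEquiv.ofFinrankEq
    (Module.finrank_fin_fun ℝ (n := Module.finrank ℝ E)).symm
  let e₂ := (e₁.arrowCongr (1 : F ≃L[ℝ] F)).trans (ContinuousLinearEquiv.piRing (Fin _))
  have h2 : ContMDiffAt 𝓘(ℝ, E) 𝓘(ℝ, Fin (Module.finrank ℝ E) → F) ∞ (fun y ↦ e₂ (f y)) x :=
    contMDiffAt_pi_space.2 fun i ↦ h _
  have h3 := e₂.symm.contDiff.contMDiff.contMDiffAt.comp (n := ∞) x h2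
  refine h3.congr_of_eventuallyEq (Eventually.of_forall fun y ↦ ?_)
  simp

/-- The Riemannian metric read in a trivialization of the tangent bundle. -/
def coordMetric (e : Trivialization E (TotalSpace.proj : TangentBundle 𝓘(ℝ, E) M → M))
    [MemTrivializationAtlas e] (y : M) : E →L[ℝ] E →L[ℝ] ℝ :=
  ((innerSL ℝ (E := TangentSpace 𝓘(ℝ, E) y)).bilinearComp (e.symmL ℝ y) (e.symmL ℝ y))

variable (e : Trivialization E (TotalSpace.proj : TangentBundle 𝓘(ℝ, E) M → M))
    [MemTrivializationAtlas e]

theorem coordMetric_apply (y : M) (u v : E) :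
    coordMetric e y u v = ⟪e.symmL ℝ y u, e.symmL ℝ y v⟫ := rfl

/-- Positive definiteness gives injectivity into the dual, and equality of dimensions does the rest.
-/
theorem isInvertible_coordMetric {y : M} (hy : y ∈ e.baseSet) :
    (coordMetric e y).IsInvertible := by
  have inj : Function.Injective (coordMetric e y) := by
    refine (injective_iff_map_eq_zero _).2 fun u hu ↦ ?_
    have h := congrArg (fun φ ↦ φ u) hu
    simp only [coordMetric_apply, zero_apply, inner_self_eq_zero] at h
    rw [← e.continuousLinearMapAt_symmL (R := ℝ) hy u, h, map_zero]
  have hfr : Module.finrank ℝ E = Module.finrank ℝ (E →L[ℝ] ℝ) := by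
    rw [← LinearMap.toContinuousLinearMap.finrank_eq, Subspace.dual_finrank_eq]
  let L := LinearEquiv.ofInjectiveOfFinrankEq (coordMetric e y).toLinearMap inj hfr
  exact ⟨L.toContinuousLinearEquiv, by ext; rfl⟩

theorem contMDiffAt_symmL_const {y : M} (hy : y ∈ e.baseSet) (v : E) :
    CMDiffAt ∞ (T% (fun z ↦ (e.symmL ℝ z v : TangentSpace 𝓘(ℝ, E) z))) y := by
  rw [e.contMDiffAt_section_iff hy]
  refine (contMDiffAt_const (c := v)).congr_of_eventuallyEq ?_
  filter_upwards [e.open_baseSet.mem_nhds hy] with z hz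
  simp [hz]

/-- A vector field is smooth if its inner products with all smooth vector fields are. -/
theorem smoothNear_of_inner
    (h : ∀ W : Π x : M, TangentSpace 𝓘(ℝ, E) x, SmoothNear W x →
      SmoothFunNear (E := E) (fun y ↦ ⟪Z y, W y⟫) x) : SmoothNear Z x := by
  set e := trivializationAt E (fun x : M ↦ TangentSpace 𝓘(ℝ, E) x) x
  have hx : x ∈ e.baseSet := mem_baseSet_trivializationAt E (fun x : M ↦ TangentSpace 𝓘(ℝ, E) x) x
  have hb := e.open_baseSet.mem_nhds hx
  let φ : M → E →L[ℝ] ℝ := fun y ↦ (innerSL ℝ (Z y)) ∘L (e.symmL ℝ y)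
  let b := Module.finBasis ℝ E
  have hs : ∀ v : E, SmoothNear (fun z ↦ (e.symmL ℝ z v : TangentSpace 𝓘(ℝ, E) z)) x := fun v ↦ by
    filter_upwards [hb] with y hy using contMDiffAt_symmL_const e hy v
  have hφb : ∀ i, SmoothFunNear (E := E) (fun y ↦ φ y (b i)) x := fun i ↦ h _ (hs (b i))
  filter_upwards [hb, eventually_all.2 hφb] with y hy hφy
  have hφ : ContMDiffAt 𝓘(ℝ, E) 𝓘(ℝ, E →L[ℝ] ℝ) ∞ φ y := contMDiffAt_clm_of_apply fun v ↦ by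
    have : (fun z ↦ φ z v) = fun z ↦ ∑ i, b.repr v i • φ z (b i) := by
      ext z
      conv_lhs => rw [← b.sum_repr v]
      rw [map_sum]
      simp_rw [map_smul]
    rw [this]
    exact ContMDiffAt.sum fun i _ ↦ (contMDiffAt_const (I' := 𝓘(ℝ, ℝ)) (c := b.repr v i)).smul (hφy i)
  have hG : ContMDiffAt 𝓘(ℝ, E) 𝓘(ℝ, E →L[ℝ] E →L[ℝ] ℝ) ∞ (coordMetric e) y :=
    contMDiffAt_clm_of_apply fun u ↦ contMDiffAt_clm_of_apply fun v ↦ by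
      have h1 : SmoothNear (fun z ↦ (e.symmL ℝ z u : TangentSpace 𝓘(ℝ, E) z)) y := by
        filter_upwards [e.open_baseSet.mem_nhds hy] with z hz using contMDiffAt_symmL_const e hz u
      have h2 : SmoothNear (fun z ↦ (e.symmL ℝ z v : TangentSpace 𝓘(ℝ, E) z)) y := by
        filter_upwards [e.open_baseSet.mem_nhds hy] with z hz using contMDiffAt_symmL_const e hz v
      exact (h1.inner h2).contMDiffAt
  have hinv := ((isInvertible_coordMetric e hy).contDiffAt_map_inverse
    (n := ∞)).contMDiffAt.comp y hG
  rw [e.contMDiffAt_section_iff hy]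
  refine (hinv.clm_apply hφ).congr_of_eventuallyEq ?_
  filter_upwards [e.open_baseSet.mem_nhds hy] with z hz
  -- The coordinates of `Z` are the inverse Gram map applied to the smooth covector `φ`; inversion
  -- is smooth at invertible maps.
  have : φ z = coordMetric e z (e ⟨z, Z z⟩).2 := by
    ext v
    simp only [φ, coordMetric_apply, ContinuousLinearMap.comp_apply, innerSL_apply_apply]
    congr 1
    simp [Trivialization.symmL_apply, hz]
  obtain ⟨L, hL⟩ := isInvertible_coordMetric e hz
  simp only [Function.comp_apply, this, ← hL]
  simp

/-- The Levi-Civita derivative of a smooth vector field along a smooth vector field is smooth. -/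
theorem SmoothNear.leviCivita [Nontrivial E] (hZ : SmoothNear Z x) (hX : SmoothNear X x) :
    SmoothNear (fun y ↦ leviCivita E M Z y (X y)) x := by
  refine smoothNear_of_inner fun W hW ↦ ?_
  -- Every term of the Koszul formula is smooth, so all inner products of `∇_X Z` are.
  have hk : SmoothFunNear (E := E) (koszul Z X W) x :=
    ((((((hZ.inner hW).deriv hX).add ((hX.inner hW).deriv hZ)).sub
      ((hX.inner hZ).deriv hW)).add ((hX.mlieBracket hZ).inner hW)).sub
      ((hX.mlieBracket hW).inner hZ)).sub ((hZ.mlieBracket hW).inner hX)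
  refine (hk.const_smul 2⁻¹).congr ?_
  filter_upwards [hZ, hX, hW] with y h1 h2 h3
  exact (inner_leviCivitaAux (h1.mdifferentiableAt (by simp)) (h2.mdifferentiableAt (by simp))
    (h3.mdifferentiableAt (by simp))).symm

end Musical

/-! ### Curvature of a general connection on vector fields. -/

section Curvature

variable {X Y Z W : Π x : M, TangentSpace 𝓘(ℝ, E) x} {x : M}

theorem mvfderiv_congr {F : Type*} [NormedAddCommGroup F] [NormedSpace ℝ F] {f g : M → F}
    (h : ∀ᶠ y in 𝓝 x, f y = g y) (v : TangentSpace 𝓘(ℝ, E) x) : d% f x v = d% g x v := by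
  have h1 : f =ᶠ[𝓝 x] g := h
  exact congrArg (fun A : TangentSpace 𝓘(ℝ, E) x →L[ℝ] F ↦ A v) (h1.mfderiv_eq (I := 𝓘(ℝ, E)))

variable (E M) in
/-- A connection on the tangent bundle. -/
abbrev Connection := CovariantDerivative 𝓘(ℝ, E) E (fun x : M ↦ TangentSpace 𝓘(ℝ, E) x)

/-- The connection `D` maps smooth vector fields to smooth vector fields. -/
def IsSmoothConnection (D : Connection E M) : Prop :=
  ∀ ⦃x : M⦄ ⦃Z X : Π x : M, TangentSpace 𝓘(ℝ, E) x⦄, SmoothNear Z x → SmoothNear X x →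
    SmoothNear (fun y ↦ D Z y (X y)) x

/-- The metric is parallel for the connection `D`. -/
def IsMetricConnection (D : Connection E M) : Prop :=
  ∀ ⦃x : M⦄ ⦃Y Z : Π x : M, TangentSpace 𝓘(ℝ, E) x⦄,
    MDiffAt (T% Y) x → MDiffAt (T% Z) x → ∀ v : TangentSpace 𝓘(ℝ, E) x,
    d% (fun y ↦ ⟪Y y, Z y⟫) x v = ⟪D Y x v, Z x⟫ + ⟪Y x, D Z x v⟫

/-- The curvature `D_{[X,Y]} Z - D_X D_Y Z + D_Y D_X Z` of a connection on vector fields. -/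
def curvatureOf (D : Connection E M) (X Y Z : Π x : M, TangentSpace 𝓘(ℝ, E) x) (x : M) :
    TangentSpace 𝓘(ℝ, E) x :=
  D Z x (mlieBracket 𝓘(ℝ, E) X Y x) - D (fun y ↦ D Z y (Y y)) x (X x)
    + D (fun y ↦ D Z y (X y)) x (Y x)

variable {D : Connection E M}

theorem connection_add (hY : MDiffAt (T% Y) x) (hZ : MDiffAt (T% Z) x) :
    D (fun y ↦ Y y + Z y) x = D Y x + D Z x :=
  D.isCovariantDerivativeOnUniv.add hY hZ

theorem connection_smul {a : M → ℝ} (ha : MDiffAt a x) (hZ : MDiffAt (T% Z) x) :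
    D (fun y ↦ a y • Z y) x = a x • D Z x + (d% a x).smulRight (Z x) :=
  D.isCovariantDerivativeOnUniv.leibniz hZ ha

theorem connection_congr (hY : MDiffAt (T% Y) x) (h : ∀ᶠ y in 𝓝 x, Y y = Z y) :
    D Y x = D Z x := by
  refine D.isCovariantDerivativeOnUniv.congr_of_eventuallyEq hY ?_ univ_mem h
  exact hY.congr_of_eventuallyEq (h.mono fun y hy ↦ by simp [hy])

theorem connection_sub (hY : MDiffAt (T% Y) x) (hZ : MDiffAt (T% Z) x) :
    D (fun y ↦ Y y - Z y) x = D Y x - D Z x := by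
  have h := connection_add (D := D) (mdifferentiableAt_sub_section hY hZ) hZ
  simp only [Pi.sub_apply, sub_add_cancel] at h
  exact eq_sub_of_add_eq h.symm

theorem isSmoothConnection_leviCivita [Nontrivial E] : IsSmoothConnection (leviCivita E M) :=
  fun _ _ _ hZ hX ↦ hZ.leviCivita hX

theorem isMetricConnection_leviCivita : IsMetricConnection (leviCivita E M) :=
  fun _ _ _ hY hZ v ↦ leviCivita_metric hY hZ v

theorem curvatureOf_swap (D : Connection E M) (X Y Z : Π x : M, TangentSpace 𝓘(ℝ, E) x) (x : M) :
    curvatureOf D Y X Z x = -curvatureOf D X Y Z x := by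
  rw [curvatureOf, curvatureOf, mlieBracket_swap_apply, map_neg]
  abel

/-- The curvature of a metric connection is skew-symmetric. -/
theorem inner_curvatureOf [Nontrivial E] (hs : IsSmoothConnection D) (hm : IsMetricConnection D)
    (hX : SmoothNear X x) (hY : SmoothNear Y x) (hZ : SmoothNear Z x) (hW : SmoothNear W x) :
    ⟪curvatureOf D X Y Z x, W x⟫ = -⟪Z x, curvatureOf D X Y W x⟫ := by
  -- Differentiating `⟨Z, W⟩` twice produces cross terms that are symmetric in `U` and `V`; they
  -- drop out of the commutator, which equals the derivative along the bracket.
  have key : ∀ {U V : Π x : M, TangentSpace 𝓘(ℝ, E) x}, SmoothNear U x → SmoothNear V x →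
      d% (fun y ↦ d% (fun z ↦ ⟪Z z, W z⟫) y (V y)) x (U x) =
        ⟪D (fun y ↦ D Z y (V y)) x (U x), W x⟫ + ⟪D Z x (V x), D W x (U x)⟫
        + (⟪D Z x (U x), D W x (V x)⟫ + ⟪Z x, D (fun y ↦ D W y (V y)) x (U x)⟫) := by
    intro U V hU hV
    have e : ∀ᶠ y in 𝓝 x, d% (fun z ↦ ⟪Z z, W z⟫) y (V y) =
        ⟪D Z y (V y), W y⟫ + ⟪Z y, D W y (V y)⟫ := by
      filter_upwards [hZ, hW] with y h1 h2
      exact hm (h1.mdifferentiableAt (by simp)) (h2.mdifferentiableAt (by simp)) _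
    rw [mvfderiv_congr e, mvfderiv_fun_add ((hs hZ hV).inner hW).mdifferentiableAt
      (hZ.inner (hs hW hV)).mdifferentiableAt, add_apply,
      hm (hs hZ hV).mdifferentiableAt hW.mdifferentiableAt,
      hm hZ.mdifferentiableAt (hs hW hV).mdifferentiableAt]
  have h := mvfderiv_mlieBracket (hZ.inner hW) hX hY
  rw [key hX hY, key hY hX, hm hZ.mdifferentiableAt hW.mdifferentiableAt] at h
  simp only [curvatureOf, inner_sub_left, inner_add_left, inner_sub_right, inner_add_right]
  linarith

/-- The first Bianchi identity for the Levi-Civita connection. -/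
theorem curvatureOf_leviCivita_bianchi [Nontrivial E]
    (hX : SmoothNear X x) (hY : SmoothNear Y x) (hZ : SmoothNear Z x) :
    curvatureOf (leviCivita E M) X Y Z x + curvatureOf (leviCivita E M) Y Z X x
      + curvatureOf (leviCivita E M) Z X Y x = 0 := by
  have hs := isSmoothConnection_leviCivita (E := E) (M := M)
  have hm : ∀ {V : Π y : M, TangentSpace 𝓘(ℝ, E) y}, SmoothNear V x →
      CMDiffAt (minSmoothness ℝ 2) (T% V) x :=
    fun h ↦ h.contMDiffAt.of_le (by simpa using ENat.LEInfty.out)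
  -- Torsion-freeness turns the cyclic sum of second derivatives into derivatives of brackets. A
  -- second use of it leaves only iterated brackets, which cancel by the Jacobi identity.
  have tor : ∀ {U V : Π x : M, TangentSpace 𝓘(ℝ, E) x}, SmoothNear U x → SmoothNear V x →
      leviCivita E M (fun y ↦ leviCivita E M V y (U y)) x
        - leviCivita E M (fun y ↦ leviCivita E M U y (V y)) x =
      leviCivita E M (mlieBracket 𝓘(ℝ, E) U V) x := by
    intro U V hU hV
    rw [← connection_sub (hs hV hU).mdifferentiableAt (hs hU hV).mdifferentiableAt]
    refine connection_congr ((hs hV hU).sub (hs hU hV)).mdifferentiableAt ?_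
    filter_upwards [hU, hV] with y h1 h2
    exact leviCivita_torsion (h1.mdifferentiableAt (by simp)) (h2.mdifferentiableAt (by simp))
  have t1 := congrArg (fun A ↦ A (X x)) (tor hY hZ)
  have t2 := congrArg (fun A ↦ A (Y x)) (tor hZ hX)
  have t3 := congrArg (fun A ↦ A (Z x)) (tor hX hY)
  simp only [sub_apply] at t1 t2 t3
  have b1 := leviCivita_torsion hX.mdifferentiableAt (hY.mlieBracket hZ).mdifferentiableAt
  have b2 := leviCivita_torsion hY.mdifferentiableAt (hZ.mlieBracket hX).mdifferentiableAt
  have b3 := leviCivita_torsion hZ.mdifferentiableAt (hX.mlieBracket hY).mdifferentiableAt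
  have jac := leibniz_identity_mlieBracket_apply (hm hX) (hm hY) (hm hZ)
  have e1 : mlieBracket 𝓘(ℝ, E) (mlieBracket 𝓘(ℝ, E) X Y) Z x
      = -mlieBracket 𝓘(ℝ, E) Z (mlieBracket 𝓘(ℝ, E) X Y) x := mlieBracket_swap_apply
  have e2 : mlieBracket 𝓘(ℝ, E) Y (mlieBracket 𝓘(ℝ, E) X Z) x
      = -mlieBracket 𝓘(ℝ, E) Y (mlieBracket 𝓘(ℝ, E) Z X) x := by
    have h1 : mlieBracket 𝓘(ℝ, E) X Z = -mlieBracket 𝓘(ℝ, E) Z X := mlieBracket_swap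
    have h2 := mlieBracket_const_smul_right (I := 𝓘(ℝ, E)) (c := (-1 : ℝ)) (V := Y)
      (hZ.mlieBracket hX).mdifferentiableAt
    rw [h1, ← neg_one_smul ℝ, h2, neg_one_smul]
  rw [e1, e2, ← b1, ← b2, ← b3, ← t1, ← t2, ← t3] at jac
  rw [← sub_eq_zero] at jac
  simp only [curvatureOf]
  rw [← neg_eq_zero, ← jac]
  abel

end Curvature

/-! ### Pointwise symmetries of the Riemann tensor. -/

section CurvatureTensor

variable [Nontrivial E] {x : M}

theorem curvature_swap (a b c : TangentSpace 𝓘(ℝ, E) x) : curvature x b a c = -curvature x a b c :=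
  curvatureOf_swap (leviCivita E M) _ _ _ _

theorem inner_curvature_skew (a b c d : TangentSpace 𝓘(ℝ, E) x) :
    ⟪curvature x a b c, d⟫ = -⟪curvature x a b d, c⟫ := by
  have h := inner_curvatureOf isSmoothConnection_leviCivita isMetricConnection_leviCivita
    (smoothNear_extend a) (smoothNear_extend b) (smoothNear_extend c) (smoothNear_extend d)
  rw [extend_apply_self, extend_apply_self, real_inner_comm _ c] at h
  exact h

theorem curvature_bianchi (a b c : TangentSpace 𝓘(ℝ, E) x) :
    curvature x a b c + curvature x b c a + curvature x c a b = 0 :=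
  curvatureOf_leviCivita_bianchi (smoothNear_extend a) (smoothNear_extend b) (smoothNear_extend c)

/-- The classical octahedron argument: four Bianchi identities are combined, and skewness in each
pair of slots removes the unwanted terms. -/
theorem inner_curvature_pair_symm (a b c d : TangentSpace 𝓘(ℝ, E) x) :
    ⟪curvature x a b c, d⟫ = ⟪curvature x c d a, b⟫ := by
  have B : ∀ a b c d : TangentSpace 𝓘(ℝ, E) x, ⟪curvature x a b c, d⟫ + ⟪curvature x b c a, d⟫
      + ⟪curvature x c a b, d⟫ = 0 := fun a b c d ↦ by
    rw [← inner_add_left, ← inner_add_left, curvature_bianchi, inner_zero_left]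
  have s : ∀ a b c d : TangentSpace 𝓘(ℝ, E) x, ⟪curvature x b a c, d⟫ = -⟪curvature x a b c, d⟫ :=
    fun a b c d ↦ by rw [curvature_swap, inner_neg_left]
  have k := inner_curvature_skew (E := E) (x := x)
  linarith [B a b c d, B b c d a, B c d a b, B d a b c, s a c b d, k a c b d, s b d c a,
    k b d c a, s c a d b, k c a d b, s d b a c, k d b a c, k a b c d, k b c d a, k c d a b,
    k d a b c, k b c a d, k c a b d, k a b d c, s a b d c, s c d b a, k c d b a, k d b c a,
    k d a c b, s b c a d, s d a b c, k a c d b, s a c d b, s b d a c, s d a c b]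

/-- The endomorphism `v ↦ R_{a,v} c`. -/
def curvatureMid (x : M) (a c : TangentSpace 𝓘(ℝ, E) x) :
    TangentSpace 𝓘(ℝ, E) x →ₗ[ℝ] TangentSpace 𝓘(ℝ, E) x where
  toFun v := curvature x a v c
  -- Linearity in the middle slot comes from pair symmetry, which moves `v` into the second slot of
  -- the inner product.
  map_add' v w := ext_inner_right ℝ fun u ↦ by
    simp only [inner_add_left, inner_curvature_pair_symm a _ c u, inner_add_right]
  map_smul' r v := ext_inner_right ℝ fun u ↦ by
    simp only [RingHom.id_apply, real_inner_smul_left, inner_curvature_pair_symm a _ c u,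
      real_inner_smul_right]

theorem curvatureMid_apply (a v c : TangentSpace 𝓘(ℝ, E) x) :
    curvatureMid x a c v = curvature x a v c := rfl

end CurvatureTensor

/-! ### Almost Hermitian geometry: torsion, `U(n)`-curvature and the two Ricci tensors. -/

namespace AlmostHermitian

variable (S : AlmostHermitian E M) {X Y Z W : Π x : M, TangentSpace 𝓘(ℝ, E) x} {x : M}

theorem inner_J_left (x : M) (v w : TangentSpace 𝓘(ℝ, E) x) : ⟪S.J x v, w⟫ = -⟪v, S.J x w⟫ := by
  rw [← S.inner_J_J x v, S.J_J, inner_neg_right, neg_neg]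

theorem smoothNear_J (hY : SmoothNear Y x) : SmoothNear (fun y ↦ S.J y (Y y)) x := by
  filter_upwards [hY] with y h using (S.smooth_J y).clm_bundle_apply h

/-! ### The intrinsic torsion -/

theorem xi_add_left (x : M) (u v w : TangentSpace 𝓘(ℝ, E) x) :
    S.xi x (u + v) w = S.xi x u w + S.xi x v w := map_add (S.torsion x w) u v

theorem xi_sub_left (x : M) (u v w : TangentSpace 𝓘(ℝ, E) x) :
    S.xi x (u - v) w = S.xi x u w - S.xi x v w := map_sub (S.torsion x w) u v

theorem xi_add_right (x : M) (u v w : TangentSpace 𝓘(ℝ, E) x) :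
    S.xi x u (v + w) = S.xi x u v + S.xi x u w := by
  simp only [xi, map_add, add_apply]

theorem xi_neg_right (x : M) (u v : TangentSpace 𝓘(ℝ, E) x) :
    S.xi x u (-v) = -S.xi x u v := by
  simp only [xi, map_neg, neg_apply]

theorem xi_apply (hY : MDiffAt (T% Y) x) (v : TangentSpace 𝓘(ℝ, E) x) :
    S.xi x v (Y x) = (-(1 / 2) : ℝ) • S.J x
      (leviCivita E M (fun y ↦ S.J y (Y y)) x v - S.J x (leviCivita E M Y x v)) :=
  congrArg (fun A ↦ A v) (TensorialAt.mkHom_apply (S.torsionAux_tensorial x) hY)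

/-- The definition of `ξ` solved for `∇J`: by `J² = -1`, `(∇_v J) Y = 2 J ξ_v Y`. -/
theorem leviCivita_J (hY : MDiffAt (T% Y) x) (v : TangentSpace 𝓘(ℝ, E) x) :
    leviCivita E M (fun y ↦ S.J y (Y y)) x v =
      S.J x (leviCivita E M Y x v) + (2 : ℝ) • S.J x (S.xi x v (Y x)) := by
  rw [S.xi_apply hY, map_smul, S.J_J]
  module

/-- Differentiating `J² = -1` shows that `∇_v J` anticommutes with `J`. -/
theorem xi_J (x : M) (v w : TangentSpace 𝓘(ℝ, E) x) : S.xi x v (S.J x w) = -S.J x (S.xi x v w) := by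
  have hY : MDiffAt (T% (extend E w)) x := mdifferentiableAt_extend ..
  have h2 := S.leviCivita_J (S.mdifferentiableAt_J hY) v
  have h3 := connection_smul (D := leviCivita E M) (a := fun _ ↦ -1) mdifferentiableAt_const hY
  simp only [S.J_J] at h2
  simp only [neg_smul, one_smul] at h3
  rw [h3, S.leviCivita_J hY] at h2
  simp only [extend_apply_self, mvfderiv_const, map_add, map_smul, S.J_J] at h2
  have h4 : S.J x (S.xi x v (S.J x w)) = S.xi x v w := by
    have : (2 : ℝ) • (S.J x (S.xi x v (S.J x w)) - S.xi x v w) = 0 := by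
      simp at h2
      rw [← sub_eq_zero] at h2
      rw [← neg_eq_zero, ← h2]
      module
    simpa [sub_eq_zero] using this
  rw [← h4, S.J_J, neg_neg]

/-- `∇_v J = 2 J ξ_v` is skew because `J` is skew and `∇` is metric: differentiate `⟨JV, W⟩ = -⟨V,
JW⟩`. -/
theorem inner_J_xi (x : M) (u v w : TangentSpace 𝓘(ℝ, E) x) :
    ⟪S.J x (S.xi x u v), w⟫ = -⟪v, S.J x (S.xi x u w)⟫ := by
  have hV : MDiffAt (T% (extend E v)) x := mdifferentiableAt_extend ..
  have hW : MDiffAt (T% (extend E w)) x := mdifferentiableAt_extend ..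
  have h1 := leviCivita_metric (S.mdifferentiableAt_J hV) hW u
  have h2 := leviCivita_metric hV (S.mdifferentiableAt_J hW) u
  simp only [S.inner_J_left] at h1
  rw [mvfderiv_fun_neg, neg_apply, h2, S.leviCivita_J hV, S.leviCivita_J hW] at h1
  simp only [extend_apply_self, inner_add_left, inner_add_right, real_inner_smul_left,
    real_inner_smul_right, S.inner_J_left] at h1
  rw [S.inner_J_left]
  linarith

/-- The intrinsic torsion is skew-symmetric. -/
theorem inner_xi (x : M) (u v w : TangentSpace 𝓘(ℝ, E) x) :
    ⟪S.xi x u v, w⟫ = -⟪v, S.xi x u w⟫ := by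
  have h := S.inner_J_xi x u v (S.J x w)
  rwa [S.inner_J_J, S.xi_J, map_neg, S.J_J, neg_neg] at h

theorem smoothNear_xi [Nontrivial E] (hX : SmoothNear X x) (hY : SmoothNear Y x) :
    SmoothNear (fun y ↦ S.xi y (X y) (Y y)) x := by
  refine (((S.smoothNear_J ((isSmoothConnection_leviCivita (S.smoothNear_J hY) hX).sub
    (S.smoothNear_J (isSmoothConnection_leviCivita hY hX))))).const_smul (-(1 / 2))).congr ?_
  filter_upwards [hY] with y h
  exact (S.xi_apply (h.mdifferentiableAt (by simp)) _).symm

/-! ### The minimal `U(n)`-connection -/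

theorem minimalUConnection_apply (Y : Π x : M, TangentSpace 𝓘(ℝ, E) x) (x : M)
    (v : TangentSpace 𝓘(ℝ, E) x) :
    S.minimalUConnection Y x v = leviCivita E M Y x v + S.xi x v (Y x) := rfl

theorem isSmoothConnection_minimalU [Nontrivial E] : IsSmoothConnection S.minimalUConnection :=
  fun _ _ _ hZ hX ↦ (isSmoothConnection_leviCivita hZ hX).add (S.smoothNear_xi hX hZ)

theorem isMetricConnection_minimalU : IsMetricConnection S.minimalUConnection := by
  intro x Y Z hY hZ v
  rw [leviCivita_metric hY hZ v, minimalUConnection_apply, minimalUConnection_apply,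
    inner_add_left, inner_add_right, S.inner_xi]
  ring

theorem minimalUConnection_J (hY : MDiffAt (T% Y) x) (v : TangentSpace 𝓘(ℝ, E) x) :
    S.minimalUConnection (fun y ↦ S.J y (Y y)) x v = S.J x (S.minimalUConnection Y x v) := by
  rw [minimalUConnection_apply, minimalUConnection_apply, S.leviCivita_J hY, S.xi_J, map_add]
  module

theorem minimalUConnection_neg_J (hY : MDiffAt (T% Y) x) (v : TangentSpace 𝓘(ℝ, E) x) :
    S.minimalUConnection (fun y ↦ -S.J y (Y y)) x v = -S.J x (S.minimalUConnection Y x v) := by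
  have h := connection_smul (D := S.minimalUConnection) (a := fun _ ↦ -1) mdifferentiableAt_const
    (S.mdifferentiableAt_J hY)
  simp only [neg_smul, one_smul] at h
  rw [h, ← S.minimalUConnection_J hY]
  simp [mvfderiv_const]

theorem curvatureOf_minimalU_J [Nontrivial E] (hX : SmoothNear X x) (hY : SmoothNear Y x)
    (hZ : SmoothNear Z x) :
    curvatureOf S.minimalUConnection X Y (fun y ↦ S.J y (Z y)) x =
      S.J x (curvatureOf S.minimalUConnection X Y Z x) := by
  have key : ∀ {U V : Π x : M, TangentSpace 𝓘(ℝ, E) x}, SmoothNear U x → SmoothNear V x →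
      S.minimalUConnection
        (fun y ↦ S.minimalUConnection (fun z ↦ S.J z (Z z)) y (V y)) x (U x) =
      S.J x (S.minimalUConnection (fun y ↦ S.minimalUConnection Z y (V y)) x (U x)) := by
    intro U V hU hV
    have hs := S.isSmoothConnection_minimalU
    rw [← S.minimalUConnection_J (hs hZ hV).mdifferentiableAt]
    refine congrArg (fun A ↦ A (U x))
      (connection_congr (hs (S.smoothNear_J hZ) hV).mdifferentiableAt ?_)
    filter_upwards [hZ] with y h using S.minimalUConnection_J (h.mdifferentiableAt (by simp)) _
  rw [curvatureOf, curvatureOf, key hX hY, key hY hX, S.minimalUConnection_J hZ.mdifferentiableAt,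
    map_add, map_sub]

/-- The covariant derivative `(∇ᵁ_X ξ)_Y Z` of the intrinsic torsion on vector fields. -/
def nablaXiField (X Y Z : Π x : M, TangentSpace 𝓘(ℝ, E) x) (x : M) : TangentSpace 𝓘(ℝ, E) x :=
  S.minimalUConnection (fun y ↦ S.xi y (Y y) (Z y)) x (X x)
    - S.xi x (S.minimalUConnection Y x (X x)) (Z x)
    - S.xi x (Y x) (S.minimalUConnection Z x (X x))

theorem nablaXi_eq (a b c : TangentSpace 𝓘(ℝ, E) x) :
    S.nablaXi x a b c = S.nablaXiField (extend E a) (extend E b) (extend E c) x := by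
  simp only [nablaXi, nablaXiField, extend_apply_self]

/-- The curvature of the Levi-Civita connection in terms of the minimal `U(n)`-connection. -/
theorem curvatureOf_leviCivita_eq [Nontrivial E] (hX : SmoothNear X x) (hY : SmoothNear Y x)
    (hZ : SmoothNear Z x) :
    curvatureOf (leviCivita E M) X Y Z x = curvatureOf S.minimalUConnection X Y Z x
      + S.nablaXiField X Y Z x - S.nablaXiField Y X Z x
      + S.xi x (S.xi x (X x) (Y x)) (Z x) - S.xi x (S.xi x (Y x) (X x)) (Z x)
      - S.xi x (X x) (S.xi x (Y x) (Z x)) + S.xi x (Y x) (S.xi x (X x) (Z x)) := by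
  have hs := isSmoothConnection_leviCivita (E := E) (M := M)
  have key : ∀ {U V : Π x : M, TangentSpace 𝓘(ℝ, E) x}, SmoothNear U x → SmoothNear V x →
      leviCivita E M (fun y ↦ S.minimalUConnection Z y (V y)) x (U x) =
      leviCivita E M (fun y ↦ leviCivita E M Z y (V y)) x (U x) +
        leviCivita E M (fun y ↦ S.xi y (V y) (Z y)) x (U x) := by
    intro U V hU hV
    simp only [minimalUConnection_apply]
    rw [connection_add (hs hZ hV).mdifferentiableAt (S.smoothNear_xi hV hZ).mdifferentiableAt,
      add_apply]
  -- The bracket inside `ξ_{[X,Y]}` is rewritten as `∇_X Y - ∇_Y X`; replacing `∇` by `∇ᵁ - ξ` there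
  -- produces the terms `ξ_{ξ_X Y}` and `ξ_{ξ_Y X}`.
  have t := leviCivita_torsion hX.mdifferentiableAt hY.mdifferentiableAt
  simp only [curvatureOf, nablaXiField, S.minimalUConnection_apply (fun y ↦ S.xi y _ _),
    S.minimalUConnection_apply (fun y ↦ S.minimalUConnection Z y _), key hX hY, key hY hX]
  rw [S.minimalUConnection_apply Z x (mlieBracket 𝓘(ℝ, E) X Y x), ← t]
  simp only [minimalUConnection_apply, xi_add_left, xi_sub_left, xi_add_right, map_sub]
  abel

/-- A metric connection preserves the skewness of `ξ`. The identity also shows that the value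
depends on `Z` only through `Z x`. -/
theorem inner_nablaXiField [Nontrivial E] (hY : SmoothNear Y x)
    (hZ : SmoothNear Z x) (hW : SmoothNear W x) :
    ⟪S.nablaXiField X Y Z x, W x⟫ = -⟪Z x, S.nablaXiField X Y W x⟫ := by
  have hm := S.isMetricConnection_minimalU
  have h1 := hm (S.smoothNear_xi hY hZ).mdifferentiableAt hW.mdifferentiableAt (X x)
  have h2 := hm hZ.mdifferentiableAt (S.smoothNear_xi hY hW).mdifferentiableAt (X x)
  have e : (fun y ↦ ⟪S.xi y (Y y) (Z y), W y⟫) = fun y ↦ -⟪Z y, S.xi y (Y y) (W y)⟫ := by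
    ext y
    exact S.inner_xi ..
  rw [e, mvfderiv_fun_neg, neg_apply, h2, S.inner_xi x (Y x) (Z x)] at h1
  rw [nablaXiField, nablaXiField, inner_sub_left, inner_sub_left, inner_sub_right,
    inner_sub_right, S.inner_xi x (Y x), S.inner_xi x (S.minimalUConnection Y x (X x))]
  linarith

/-- `J` is parallel for `∇ᵁ`, so the derivative inherits the anticommutation from `ξ`. -/
theorem nablaXiField_J [Nontrivial E] (hY : SmoothNear Y x) (hZ : SmoothNear Z x) :
    S.nablaXiField X Y (fun y ↦ S.J y (Z y)) x = -S.J x (S.nablaXiField X Y Z x) := by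
  simp only [nablaXiField, S.xi_J]
  rw [S.minimalUConnection_J hZ.mdifferentiableAt, S.xi_J,
    S.minimalUConnection_neg_J (S.smoothNear_xi hY hZ).mdifferentiableAt]
  simp only [map_sub]
  abel

section Pointwise

variable [Nontrivial E]

theorem inner_nablaXi (x : M) (a b c d : TangentSpace 𝓘(ℝ, E) x) :
    ⟪S.nablaXi x a b c, d⟫ = -⟪c, S.nablaXi x a b d⟫ := by
  have h := S.inner_nablaXiField (X := extend E a) (smoothNear_extend b) (smoothNear_extend c)
    (smoothNear_extend d)
  rwa [← nablaXi_eq, ← nablaXi_eq, extend_apply_self, extend_apply_self] at h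

theorem nablaXi_J (x : M) (a b c : TangentSpace 𝓘(ℝ, E) x) :
    S.nablaXi x a b (S.J x c) = -S.J x (S.nablaXi x a b c) := by
  rw [nablaXi_eq _ a b c, ← S.nablaXiField_J (smoothNear_extend b) (smoothNear_extend c)]
  -- The fields `extend E (J c)` and `J (extend E c)` agree only at `x`; skewness makes this
  -- sufficient.
  refine ext_inner_right ℝ fun d ↦ ?_
  have h := S.inner_nablaXiField (X := extend E a) (smoothNear_extend b)
    (S.smoothNear_J (smoothNear_extend c)) (smoothNear_extend d)
  rw [← nablaXi_eq, extend_apply_self, extend_apply_self] at h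
  rw [h, S.inner_nablaXi]

/-- The curvature of the minimal `U(n)`-connection on tangent vectors at `x`. -/
def curvatureU (x : M) (a b c : TangentSpace 𝓘(ℝ, E) x) : TangentSpace 𝓘(ℝ, E) x :=
  curvatureOf S.minimalUConnection (extend E a) (extend E b) (extend E c) x

/-- Skewness moves the curvature onto the other argument, leaving only the value `Z x`; this is
tensoriality in the last slot. -/
theorem curvatureOf_minimalU_eq {a b : TangentSpace 𝓘(ℝ, E) x} (hZ : SmoothNear Z x) :
    curvatureOf S.minimalUConnection (extend E a) (extend E b) Z x = S.curvatureU x a b (Z x) := by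
  refine ext_inner_right ℝ fun d ↦ ?_
  have h : ∀ {V : Π x : M, TangentSpace 𝓘(ℝ, E) x}, SmoothNear V x →
      ⟪curvatureOf S.minimalUConnection (extend E a) (extend E b) V x, d⟫ =
        -⟪V x, S.curvatureU x a b d⟫ := fun {V} hV ↦ by
    have := inner_curvatureOf S.isSmoothConnection_minimalU S.isMetricConnection_minimalU
      (smoothNear_extend a) (smoothNear_extend b) hV (smoothNear_extend d)
    rwa [extend_apply_self] at this
  have h' := h (smoothNear_extend (Z x))
  rw [extend_apply_self] at h'
  exact (h hZ).trans h'.symm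

theorem inner_curvatureU (x : M) (a b c d : TangentSpace 𝓘(ℝ, E) x) :
    ⟪S.curvatureU x a b c, d⟫ = -⟪c, S.curvatureU x a b d⟫ := by
  have := inner_curvatureOf S.isSmoothConnection_minimalU S.isMetricConnection_minimalU
    (smoothNear_extend a) (smoothNear_extend b) (smoothNear_extend c) (smoothNear_extend d)
  rwa [extend_apply_self, extend_apply_self] at this

theorem curvatureU_J (x : M) (a b c : TangentSpace 𝓘(ℝ, E) x) :
    S.curvatureU x a b (S.J x c) = S.J x (S.curvatureU x a b c) := by
  have h := S.curvatureOf_minimalU_eq (a := a) (b := b) (S.smoothNear_J (smoothNear_extend c))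
  rw [S.curvatureOf_minimalU_J (smoothNear_extend a) (smoothNear_extend b)
    (smoothNear_extend c), extend_apply_self] at h
  exact h.symm

theorem curvature_eq (x : M) (a b c : TangentSpace 𝓘(ℝ, E) x) :
    curvature x a b c = S.curvatureU x a b c + S.nablaXi x a b c - S.nablaXi x b a c
      + S.xi x (S.xi x a b) c - S.xi x (S.xi x b a) c
      - S.xi x a (S.xi x b c) + S.xi x b (S.xi x a c) := by
  have h := S.curvatureOf_leviCivita_eq (smoothNear_extend a) (smoothNear_extend b)
    (smoothNear_extend c)
  simp only [← nablaXi_eq, extend_apply_self] at h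
  exact h

/-! ### The Ricci and `*`-Ricci curvatures -/

variable {ι : Type*} [Fintype ι]

/-- If `A` is skew and anticommutes with `J`, then `⟨A c, J c⟩ = 0`, so only `Rᵁ` and the commutator
of the `ξ`'s survive. The two halves of the commutator contribute equally. -/
theorem sum_inner_curvature_J {x : M} (e : OrthonormalBasis ι ℝ (TangentSpace 𝓘(ℝ, E) x))
    (a b : TangentSpace 𝓘(ℝ, E) x) :
    ∑ i, ⟪curvature x a b (e i), S.J x (e i)⟫ =
      ∑ i, ⟪S.curvatureU x a b (e i), S.J x (e i)⟫
        - 2 * ∑ i, ⟪S.xi x a (e i), S.xi x b (S.J x (e i))⟫ := by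
  rw [Finset.mul_sum, ← Finset.sum_sub_distrib]
  refine Finset.sum_congr rfl fun i _ ↦ ?_
  have anti : ∀ A : TangentSpace 𝓘(ℝ, E) x → TangentSpace 𝓘(ℝ, E) x,
      (∀ c d, ⟪A c, d⟫ = -⟪c, A d⟫) → (∀ c, A (S.J x c) = -S.J x (A c)) →
      ∀ c, ⟪A c, S.J x c⟫ = 0 := fun A h1 h2 c ↦ by
    have h3 := h1 c (S.J x c)
    rw [h2, inner_neg_right, neg_neg, ← neg_neg ⟪c, _⟫, ← S.inner_J_left] at h3
    linarith [real_inner_comm (S.J x c) (A c)]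
  rw [S.curvature_eq]
  simp only [inner_add_left, inner_sub_left]
  rw [anti (S.nablaXi x a b) (S.inner_nablaXi x a b) (S.nablaXi_J x a b),
    anti (S.nablaXi x b a) (S.inner_nablaXi x b a) (S.nablaXi_J x b a),
    anti (S.xi x _) (S.inner_xi x _) (S.xi_J x _), anti (S.xi x _) (S.inner_xi x _) (S.xi_J x _),
    S.inner_xi x a, S.inner_xi x b (S.xi x a (e i)), S.xi_J x a, inner_neg_right,
    ← neg_neg ⟪S.xi x b (e i), _⟫, ← S.inner_J_left, ← neg_neg (S.J x (S.xi x b (e i))), ← S.xi_J,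
    inner_neg_left]
  linarith [real_inner_comm (S.xi x b (S.J x (e i))) (S.xi x a (e i))]

theorem sum_inner_J (x : M) (e : OrthonormalBasis ι ℝ (TangentSpace 𝓘(ℝ, E) x))
    (A : TangentSpace 𝓘(ℝ, E) x →ₗ[ℝ] TangentSpace 𝓘(ℝ, E) x) :
    ∑ i, ⟪A (S.J x (e i)), e i⟫ = -∑ i, ⟪A (e i), S.J x (e i)⟫ := by
  have h1 := (A ∘ₗ (S.J x).toLinearMap).trace_eq_sum_inner e
  have h2 := ((S.J x).toLinearMap ∘ₗ A).trace_eq_sum_inner e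
  rw [LinearMap.trace_comp_comm', h2] at h1
  rw [← Finset.sum_neg_distrib]
  refine Eq.trans (Eq.trans ?_ h1.symm) ?_ <;> refine Finset.sum_congr rfl fun i _ ↦ ?_
  · exact real_inner_comm _ _
  · rw [← neg_neg ⟪e i, _⟫]
    exact congrArg Neg.neg ((S.inner_J_left x (e i) _).symm.trans (real_inner_comm _ _))

/-- Bianchi on `a, J b, e_i` paired with `J e_i`, with pair symmetry, gives two terms. Their sums
coincide by the trace identity `sum_inner_J`, hence the factor 2. -/
theorem two_mul_ricciStar {x : M} (e : OrthonormalBasis ι ℝ (TangentSpace 𝓘(ℝ, E) x))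
    (a b : TangentSpace 𝓘(ℝ, E) x) :
    2 * S.ricciStar e a b = ∑ i, ⟪curvature x a (S.J x b) (e i), S.J x (e i)⟫ := by
  have h := S.sum_inner_J x e (curvatureMid x a (S.J x b))
  simp only [curvatureMid_apply] at h
  have h2 : ∀ i, ⟪curvature x a (S.J x b) (e i), S.J x (e i)⟫ =
      ⟪curvature x a (e i) (S.J x b), S.J x (e i)⟫
        - ⟪curvature x a (S.J x (e i)) (S.J x b), e i⟫ := fun i ↦ by
    have B := congrArg (fun v ↦ ⟪v, S.J x (e i)⟫) (curvature_bianchi a (S.J x b) (e i))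
    simp only [inner_add_left, inner_zero_left] at B
    rw [curvature_swap a (e i), inner_neg_left,
      inner_curvature_pair_symm (S.J x b) (e i) a] at B
    linarith
  simp only [h2, Finset.sum_sub_distrib, h, ricciStar]
  ring

/-- Replacing `b, e_i` by `J b, J e_i` fixes the terms of `curvature_eq` that commute with `J` and
changes the sign of those that anticommute. -/
theorem ricci_sub_ricciStar {x : M} (e : OrthonormalBasis ι ℝ (TangentSpace 𝓘(ℝ, E) x))
    (a b : TangentSpace 𝓘(ℝ, E) x) :
    ricci e a b = S.ricciStar e a b
        - 2 * ∑ i, ⟪S.nablaXi x (e i) a b, e i⟫ + 2 * ∑ i, ⟪S.nablaXi x a (e i) b, e i⟫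
        - 2 * ∑ i, ⟪S.xi x (S.xi x (e i) a) b, e i⟫
        + 2 * ∑ i, ⟪S.xi x (S.xi x a (e i)) b, e i⟫ := by
  simp only [ricci, ricciStar, Finset.mul_sum, ← Finset.sum_sub_distrib, ← Finset.sum_add_distrib]
  refine Finset.sum_congr rfl fun i _ ↦ ?_
  rw [S.curvature_eq x a (e i) b, S.curvature_eq x a (e i) (S.J x b)]
  simp only [inner_add_left, inner_sub_left, S.curvatureU_J, S.nablaXi_J, S.xi_J, S.xi_neg_right,
    S.inner_J_J, neg_neg, inner_neg_left]
  ring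

end Pointwise

end AlmostHermitian

/-! ### The algebraic form of `η`. -/

namespace SpecialStructure

variable {n : ℕ} (S : SpecialStructure E M n) {D : Connection E M}
  {X Y Z W : Π x : M, TangentSpace 𝓘(ℝ, E) x} {x : M}

theorem connectionDifference_apply (hY : MDiffAt (T% Y) x) (v : TangentSpace 𝓘(ℝ, E) x) :
    connectionDifference D x v (Y x) = D Y x v - leviCivita E M Y x v :=
  congrArg (fun A ↦ A v) (IsCovariantDerivativeOn.difference_apply D.isCovariantDerivativeOnUniv
    (leviCivita E M).isCovariantDerivativeOnUniv (Set.mem_univ x) hY)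

theorem eta_apply (x : M) (v w : TangentSpace 𝓘(ℝ, E) x) :
    S.eta D x v w = connectionDifference D x v w - S.xi x v w := rfl

theorem connection_eq_add_eta (hY : MDiffAt (T% Y) x) (v : TangentSpace 𝓘(ℝ, E) x) :
    D Y x v = S.minimalUConnection Y x v + S.eta D x v (Y x) := by
  rw [eta_apply, connectionDifference_apply hY, S.minimalUConnection_apply]
  abel

variable {S}

theorem IsMinimalSUConnection.inner_eta (hD : S.IsMinimalSUConnection D) (x : M)
    (u v w : TangentSpace 𝓘(ℝ, E) x) : ⟪S.eta D x u v, w⟫ = -⟪v, S.eta D x u w⟫ := by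
  rw [eta_apply, eta_apply, inner_sub_left, inner_sub_right, (hD.mem_suPerp x u).1, S.inner_xi]
  ring

theorem IsMinimalSUConnection.eta_J (hD : S.IsMinimalSUConnection D) (x : M)
    (u v : TangentSpace 𝓘(ℝ, E) x) : S.eta D x u (S.J x v) = S.J x (S.eta D x u v) := by
  have hY : MDiffAt (T% (extend E v)) x := mdifferentiableAt_extend ..
  have h := hD.parallel_J x _ hY u
  rw [S.connection_eq_add_eta (S.mdifferentiableAt_J hY), S.connection_eq_add_eta hY,
    S.minimalUConnection_J hY, map_add, extend_apply_self] at h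
  exact add_left_cancel h

theorem trace_eq_zero_of_skew (x : M)
    (B : TangentSpace 𝓘(ℝ, E) x →ₗ[ℝ] TangentSpace 𝓘(ℝ, E) x)
    (hB : ∀ v w, ⟪B v, w⟫ = -⟪v, B w⟫) : LinearMap.trace ℝ (TangentSpace 𝓘(ℝ, E) x) B = 0 := by
  rw [B.trace_eq_sum_inner (stdOrthonormalBasis ℝ _)]
  refine Finset.sum_eq_zero fun i _ ↦ ?_
  linarith [hB (stdOrthonormalBasis ℝ (TangentSpace 𝓘(ℝ, E) x) i)
    (stdOrthonormalBasis ℝ (TangentSpace 𝓘(ℝ, E) x) i), real_inner_comm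
    (stdOrthonormalBasis ℝ (TangentSpace 𝓘(ℝ, E) x) i)
    (B (stdOrthonormalBasis ℝ (TangentSpace 𝓘(ℝ, E) x) i))]

/-- For skew `B`, `tr B² = -∑ ‖B e_i‖²`. -/
theorem eq_zero_of_skew_of_trace_sq (x : M)
    (B : TangentSpace 𝓘(ℝ, E) x →ₗ[ℝ] TangentSpace 𝓘(ℝ, E) x)
    (hB : ∀ v w, ⟪B v, w⟫ = -⟪v, B w⟫)
    (h : LinearMap.trace ℝ (TangentSpace 𝓘(ℝ, E) x) (B ∘ₗ B) = 0) : B = 0 := by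
  rw [LinearMap.trace_eq_sum_inner _ (stdOrthonormalBasis ℝ _)] at h
  have h2 : ∑ i, ‖B (stdOrthonormalBasis ℝ (TangentSpace 𝓘(ℝ, E) x) i)‖ ^ 2 = 0 := by
    rw [← neg_eq_zero, ← h, ← Finset.sum_neg_distrib]
    refine Finset.sum_congr rfl fun i _ ↦ ?_
    rw [← real_inner_self_eq_norm_sq, hB, neg_neg]
    rfl
  rw [Finset.sum_eq_zero_iff_of_nonneg fun i _ ↦ by positivity] at h2
  refine (stdOrthonormalBasis ℝ (TangentSpace 𝓘(ℝ, E) x)).toBasis.ext fun i ↦ ?_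
  simpa using h2 i (Finset.mem_univ i)

/-- Here `T = J T J`, so cyclicity gives `tr T = tr (T J²) = -tr T`. -/
theorem trace_eq_zero_of_anticomm (x : M)
    (T : TangentSpace 𝓘(ℝ, E) x →ₗ[ℝ] TangentSpace 𝓘(ℝ, E) x)
    (hT : ∀ v, T (S.J x v) = -S.J x (T v)) :
    LinearMap.trace ℝ (TangentSpace 𝓘(ℝ, E) x) T = 0 := by
  have e1 : (S.J x).toLinearMap ∘ₗ (T ∘ₗ (S.J x).toLinearMap) = T := by
    ext v
    change S.J x (T (S.J x v)) = T v
    rw [hT, map_neg, S.J_J, neg_neg]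
  have e2 : (T ∘ₗ (S.J x).toLinearMap) ∘ₗ (S.J x).toLinearMap = -T := by
    ext v
    change T (S.J x (S.J x v)) = -T v
    rw [S.J_J, map_neg]
  have h := LinearMap.trace_comp_comm' (S.J x).toLinearMap (T ∘ₗ (S.J x).toLinearMap)
  rw [e1, e2, map_neg] at h
  linarith

/-- The part `η` of the intrinsic `SU(n)`-torsion is `η_X Y = η̂(X) J Y`. -/
theorem IsMinimalSUConnection.eta_eq (hD : S.IsMinimalSUConnection D) (hn : n ≠ 0)
    (hE : Module.finrank ℝ E = 2 * n) (x : M) (u v : TangentSpace 𝓘(ℝ, E) x) :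
    S.eta D x u v = S.etaHat D x u • S.J x v := by
  set c := S.etaHat D x u
  -- The part of `η_u` orthogonal to `J`. It lies in `su(n)`, and it vanishes because `tr B² = 0`.
  set B : TangentSpace 𝓘(ℝ, E) x →L[ℝ] TangentSpace 𝓘(ℝ, E) x := S.eta D x u - c • S.J x
  have hB : ∀ w, B w = S.eta D x u w - c • S.J x w := fun w ↦ rfl
  have hskew : ∀ v w, ⟪B v, w⟫ = -⟪v, B w⟫ := fun v w ↦ by
    rw [hB, hB, inner_sub_left, inner_sub_right, hD.inner_eta, real_inner_smul_left,
      real_inner_smul_right, S.inner_J_left]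
    ring
  have hJ : ∀ v, B (S.J x v) = S.J x (B v) := fun v ↦ by
    rw [hB, hB, hD.eta_J, map_sub, map_smul]
  have hJB : LinearMap.trace ℝ (TangentSpace 𝓘(ℝ, E) x) (S.J x ∘L B).toLinearMap = 0 := by
    have e : (S.J x ∘L B).toLinearMap = (S.J x ∘L S.eta D x u).toLinearMap + c • LinearMap.id := by
      ext w
      change S.J x (B w) = S.J x (S.eta D x u w) + c • w
      rw [hB, map_sub, map_smul, S.J_J]
      module
    have hfr : Module.finrank ℝ (TangentSpace 𝓘(ℝ, E) x) = 2 * n := hE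
    rw [e, map_add, map_smul, LinearMap.trace_id, hfr]
    simp only [c, etaHat, smul_eq_mul]
    push_cast
    have : (n : ℝ) ≠ 0 := Nat.cast_ne_zero.2 hn
    field_simp
    ring
  have hsu : B ∈ S.suAlgebra x := ⟨hskew, hJ, trace_eq_zero_of_skew x _ hskew, hJB⟩
  have hperp := (hD.mem_suPerp x u).2 B hsu
  have hxi : LinearMap.trace ℝ (TangentSpace 𝓘(ℝ, E) x)
      (((ContinuousLinearMap.apply ℝ (TangentSpace 𝓘(ℝ, E) x) u) ∘L (S.torsion x)) ∘L B).toLinearMap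
        = 0 := by
    refine trace_eq_zero_of_anticomm (S := S) x _ fun v ↦ ?_
    change S.xi x u (B (S.J x v)) = -S.J x (S.xi x u (B v))
    rw [hJ, S.xi_J]
  have hBB : LinearMap.trace ℝ (TangentSpace 𝓘(ℝ, E) x) (B.toLinearMap ∘ₗ B.toLinearMap) = 0 := by
    -- Split the left factor as `B = (D - ∇)_u - ξ_u - c J`: the first piece is orthogonal to
    -- `su(n)`, `ξ_u B` anticommutes with `J`, and `tr (J B) = 0`.
    have e : B.toLinearMap ∘ₗ B.toLinearMap = (connectionDifference D x u ∘L B).toLinearMap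
        - (((ContinuousLinearMap.apply ℝ (TangentSpace 𝓘(ℝ, E) x) u) ∘L
          (S.torsion x)) ∘L B).toLinearMap - c • (S.J x ∘L B).toLinearMap := rfl
    rw [e, map_sub, map_sub, map_smul, hperp, hxi, hJB]
    simp
  have h0 := congrArg (fun A ↦ A v) (eq_zero_of_skew_of_trace_sq x B.toLinearMap hskew hBB)
  exact sub_eq_zero.1 h0

end SpecialStructure

/-! ### The same calculus for complex-valued functions, through real and imaginary parts. -/

section ComplexFunctions

variable {X Y : Π x : M, TangentSpace 𝓘(ℝ, E) x} {x : M} {f : M → ℂ}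
  {F G : Type*} [NormedAddCommGroup F] [NormedSpace ℝ F] [NormedAddCommGroup G] [NormedSpace ℝ G]

theorem mvfderiv_clm_comp (L : F →L[ℝ] G) {f : M → F} (hf : MDifferentiableAt 𝓘(ℝ, E) 𝓘(ℝ, F) f x)
    (v : TangentSpace 𝓘(ℝ, E) x) : d% (fun y ↦ L (f y)) x v = L (d% f x v) := by
  have h := mfderiv_comp_apply (I := 𝓘(ℝ, E)) x
    (L.hasMFDerivAt (x := f x)).mdifferentiableAt hf v
  rw [L.hasMFDerivAt.mfderiv] at h
  exact h

theorem SmoothFunNear.clm_comp (L : F →L[ℝ] G) {f : M → F} (hf : SmoothFunNear (E := E) f x) :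
    SmoothFunNear (E := E) (fun y ↦ L (f y)) x := by
  filter_upwards [hf] with y h using L.contDiff.contMDiff.contMDiffAt.comp y h

theorem SmoothFunNear.deriv_complex [Nontrivial E] (hf : SmoothFunNear (E := E) f x)
    (hX : SmoothNear X x) : SmoothFunNear (E := E) (fun y ↦ d% f y (X y)) x := by
  have h1 := ((hf.clm_comp Complex.reCLM).deriv hX).clm_comp Complex.ofRealCLM
  have h2 := ((hf.clm_comp Complex.imCLM).deriv hX).clm_comp
    ((ContinuousLinearMap.mul ℝ ℂ Complex.I) ∘L Complex.ofRealCLM)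
  refine (h1.add h2).congr ?_
  filter_upwards [hf] with y h
  rw [mvfderiv_clm_comp _ (h.mdifferentiableAt (by simp)),
    mvfderiv_clm_comp _ (h.mdifferentiableAt (by simp))]
  change ((Complex.re _ : ℝ) : ℂ) + Complex.I * ((Complex.im _ : ℝ) : ℂ) = _
  rw [mul_comm, Complex.re_add_im]

theorem mvfderiv_mlieBracket_complex [Nontrivial E] (hf : SmoothFunNear (E := E) f x)
    (hX : SmoothNear X x) (hY : SmoothNear Y x) :
    d% f x (mlieBracket 𝓘(ℝ, E) X Y x) =
      d% (fun y ↦ d% f y (Y y)) x (X x) - d% (fun y ↦ d% f y (X y)) x (Y x) := by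
  have key : ∀ L : ℂ →L[ℝ] ℝ, L (d% f x (mlieBracket 𝓘(ℝ, E) X Y x)) =
      L (d% (fun y ↦ d% f y (Y y)) x (X x)) - L (d% (fun y ↦ d% f y (X y)) x (Y x)) := by
    intro L
    have h := mvfderiv_mlieBracket (hf.clm_comp L) hX hY
    have e : ∀ {V : Π x : M, TangentSpace 𝓘(ℝ, E) x},
        ∀ᶠ y in 𝓝 x, d% (fun z ↦ L (f z)) y (V y) = L (d% f y (V y)) := fun {V} ↦ by
      filter_upwards [hf] with y h using mvfderiv_clm_comp L (h.mdifferentiableAt (by simp)) _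
    rwa [mvfderiv_congr e, mvfderiv_congr e, mvfderiv_clm_comp _ hf.mdifferentiableAt,
      mvfderiv_clm_comp _ (hf.deriv_complex hX).mdifferentiableAt,
      mvfderiv_clm_comp _ (hf.deriv_complex hY).mdifferentiableAt] at h
  exact Complex.ext (key Complex.reCLM) (key Complex.imCLM)

theorem SmoothFunNear.sum {ι : Type*} {s : Finset ι} {f : ι → M → F}
    (hf : ∀ i ∈ s, SmoothFunNear (E := E) (f i) x) :
    SmoothFunNear (E := E) (fun y ↦ ∑ i ∈ s, f i y) x := by
  filter_upwards [(eventually_all_finset s).2 hf] with y h using ContMDiffAt.sum h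

theorem mvfderiv_fun_sum {ι : Type*} {s : Finset ι} {f : ι → M → F}
    (hf : ∀ i ∈ s, SmoothFunNear (E := E) (f i) x) (v : TangentSpace 𝓘(ℝ, E) x) :
    d% (fun y ↦ ∑ i ∈ s, f i y) x v = ∑ i ∈ s, d% (f i) x v := by
  classical
  induction s using Finset.induction_on with
  | empty => simp [mvfderiv_const]
  | insert i s hi ih =>
    simp only [Finset.sum_insert hi]
    rw [mvfderiv_fun_add (hf i (by simp)).mdifferentiableAt
      (SmoothFunNear.sum fun j hj ↦ hf j (by simp [hj])).mdifferentiableAt, add_apply,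
      ih fun j hj ↦ hf j (by simp [hj])]

theorem SmoothFunNear.div_complex {g : M → ℂ} (hf : SmoothFunNear (E := E) f x)
    (hg : SmoothFunNear (E := E) g x) (h0 : g x ≠ 0) :
    SmoothFunNear (E := E) (fun y ↦ f y / g y) x := by
  filter_upwards [hf, hg, hg.contMDiffAt.continuousAt.eventually_ne h0] with y h1 h2 h3
  have hd : ContDiffAt ℝ ∞ (fun p : ℂ × ℂ ↦ p.1 / p.2) (f y, g y) :=
    by
      simp only [div_eq_mul_inv]
      exact contDiffAt_fst.mul (contDiffAt_snd.inv h3)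
  exact hd.contMDiffAt.comp y (h1.prodMk_space h2)

end ComplexFunctions

/-! ### Traces against `J` and existence of unitary systems. -/

section UnitaryBasis

variable (S : AlmostHermitian E M)

theorem AlmostHermitian.sum_inner_J_eq_trace {x : M} {ι : Type*} [Fintype ι]
    (e : OrthonormalBasis ι ℝ (TangentSpace 𝓘(ℝ, E) x))
    (B : TangentSpace 𝓘(ℝ, E) x →ₗ[ℝ] TangentSpace 𝓘(ℝ, E) x) :
    ∑ i, ⟪B (e i), S.J x (e i)⟫ =
      -LinearMap.trace ℝ (TangentSpace 𝓘(ℝ, E) x) ((S.J x).toLinearMap ∘ₗ B) := by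
  rw [LinearMap.trace_eq_sum_inner _ e, ← Finset.sum_neg_distrib]
  refine Finset.sum_congr rfl fun i _ ↦ ?_
  change _ = -⟪e i, S.J x (B (e i))⟫
  rw [real_inner_comm, ← S.inner_J_left]

/-- A tangent space of dimension at least `2k` contains a unitary system of `k` vectors. -/
theorem AlmostHermitian.exists_unitary_system (x : M) (k : ℕ)
    (hk : 2 * k ≤ Module.finrank ℝ E) :
    ∃ u : Fin k → TangentSpace 𝓘(ℝ, E) x, (∀ i j, ⟪u i, u j⟫ = if i = j then (1 : ℝ) else 0) ∧
      ∀ i j, ⟪u i, S.J x (u j)⟫ = (0 : ℝ) := by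
  induction k with
  | zero => exact ⟨Fin.elim0, fun i ↦ i.elim0, fun i ↦ i.elim0⟩
  | succ k ih =>
    obtain ⟨u, hu, hJ⟩ := ih (by omega)
    let W : Submodule ℝ (TangentSpace 𝓘(ℝ, E) x) :=
      Submodule.span ℝ (Set.range (Sum.elim u fun i ↦ S.J x (u i)))
    have hW : Module.finrank ℝ W < Module.finrank ℝ (TangentSpace 𝓘(ℝ, E) x) := by
      have h1 := finrank_range_le_card (R := ℝ) (Sum.elim u fun i ↦ S.J x (u i))
      have h2 : Module.finrank ℝ (TangentSpace 𝓘(ℝ, E) x) = Module.finrank ℝ E := rfl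
      simp only [Set.finrank, Fintype.card_sum, Fintype.card_fin] at h1
      change Module.finrank ℝ W ≤ _ at h1
      omega
    have hne : Wᗮ ≠ ⊥ := fun h ↦ by
      rw [Submodule.orthogonal_eq_bot_iff] at h
      rw [h, finrank_top] at hW
      exact lt_irrefl _ hW
    obtain ⟨w₀, hw₀, hw0⟩ := Submodule.exists_mem_ne_zero_of_ne_bot hne
    set w := ‖w₀‖⁻¹ • w₀
    have hw : w ∈ Wᗮ := Wᗮ.smul_mem _ hw₀
    have hww : ⟪w, w⟫ = (1 : ℝ) := by
      rw [real_inner_self_eq_norm_sq, norm_smul, norm_inv, norm_norm,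
        inv_mul_cancel₀ (norm_ne_zero_iff.2 hw0), one_pow]
    have hwu : ∀ i, ⟪u i, w⟫ = (0 : ℝ) := fun i ↦
      (W.mem_orthogonal w).1 hw _ (Submodule.subset_span ⟨Sum.inl i, rfl⟩)
    have hwJ : ∀ i, ⟪S.J x (u i), w⟫ = (0 : ℝ) := fun i ↦
      (W.mem_orthogonal w).1 hw _ (Submodule.subset_span ⟨Sum.inr i, rfl⟩)
    -- Orthogonality to the span covers the old vectors; `w ⊥ J w` is automatic since `J` is skew.
    have hwJw : ⟪w, S.J x w⟫ = (0 : ℝ) := by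
      linarith [S.inner_J_left x w w, real_inner_comm w (S.J x w)]
    refine ⟨Fin.cons w u, fun i j ↦ ?_, fun i j ↦ ?_⟩
    · refine Fin.cases ?_ (fun i ↦ ?_) i <;> refine Fin.cases ?_ (fun j ↦ ?_) j
      · simpa using hww
      · simpa [Fin.succ_ne_zero, eq_comm, real_inner_comm] using hwu j
      · simpa [Fin.succ_ne_zero] using hwu i
      · simpa using hu i j
    · refine Fin.cases ?_ (fun i ↦ ?_) i <;> refine Fin.cases ?_ (fun j ↦ ?_) j
      · simpa using hwJw
      · simpa [real_inner_comm] using hwJ j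
      · have := S.inner_J_left x (u i) w
        rw [hwJ] at this
        simpa using this.symm
      · simpa using hJ i j

end UnitaryBasis

/-! ### Pointwise algebra of `Ψ`. -/

namespace SpecialStructure

variable {n : ℕ} (S : SpecialStructure E M n) {D : Connection E M}
  {X Y Z W : Π x : M, TangentSpace 𝓘(ℝ, E) x} {x : M}

theorem hermitian_eq {u : Fin n → TangentSpace 𝓘(ℝ, E) x}
    (hu : ∀ i j, ⟪u i, u j⟫ = if i = j then (1 : ℝ) else 0)
    (hJ : ∀ i j, ⟪u i, S.J x (u j)⟫ = (0 : ℝ)) (i j : Fin n) :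
    S.hermitian x (u i) (u j) = if i = j then 1 else 0 := by
  rw [AlmostHermitian.hermitian, hu, hJ]
  split_ifs <;> simp

/-- If `Ψ u` vanished, so would every term of the normalising sum: a permutation of `u` only changes
the sign, and a repeated vector gives zero. -/
theorem Ψ_ne_zero {u : Fin n → TangentSpace 𝓘(ℝ, E) x}
    (hu : ∀ i j, S.hermitian x (u i) (u j) = if i = j then 1 else 0) : S.Ψ x u ≠ 0 := by
  intro h0
  have h := S.norm_Ψ x u hu
  have hz : ∀ k : Fin n → Fin n, S.Ψ x (fun i ↦ u (k i)) = 0 := fun k ↦ by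
    by_cases hk : Function.Injective k
    · let σ : Equiv.Perm (Fin n) := Equiv.ofBijective k (Finite.injective_iff_bijective.1 hk)
      have := (S.Ψ x).toAlternatingMap.map_perm u σ
      change S.Ψ x (fun i ↦ u (k i)) = _ at this
      rw [this]
      change _ • S.Ψ x u = 0
      rw [h0, smul_zero]
    · simp only [Function.Injective, not_forall] at hk
      obtain ⟨i, j, hij, hne⟩ := hk
      exact (S.Ψ x).map_eq_zero_of_eq _ (by simp only [hij]) hne
  simp [hz] at h

/-- `Ψ` transforms under a skew-symmetric complex linear endomorphism by its complex trace. -/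
theorem sum_Ψ_update (hE : Module.finrank ℝ E = 2 * n)
    {u : Fin n → TangentSpace 𝓘(ℝ, E) x}
    (hu : ∀ i j, ⟪u i, u j⟫ = if i = j then (1 : ℝ) else 0)
    (hJ : ∀ i j, ⟪u i, S.J x (u j)⟫ = (0 : ℝ))
    (B : TangentSpace 𝓘(ℝ, E) x →ₗ[ℝ] TangentSpace 𝓘(ℝ, E) x)
    (hB : ∀ v w, ⟪B v, w⟫ = -⟪v, B w⟫) (hBJ : ∀ v, B (S.J x v) = S.J x (B v))
    {ι : Type*} [Fintype ι] (e : OrthonormalBasis ι ℝ (TangentSpace 𝓘(ℝ, E) x)) :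
    ∑ j, S.Ψ x (Function.update u j (B (u j))) =
      Complex.I / 2 * (∑ i, ⟪B (e i), S.J x (e i)⟫ : ℝ) * S.Ψ x u := by
  have hon : Orthonormal ℝ (Sum.elim u fun i ↦ S.J x (u i)) := by
    rw [orthonormal_iff_ite]
    rintro (i | i) (j | j)
    · simpa using hu i j
    · simpa using hJ i j
    · simpa [real_inner_comm] using hJ j i
    · simpa [S.inner_J_J] using hu i j
  have hcard : Fintype.card (Fin n ⊕ Fin n) = Module.finrank ℝ (TangentSpace 𝓘(ℝ, E) x) := by
    have h2 : Module.finrank ℝ (TangentSpace 𝓘(ℝ, E) x) = 2 * n := hE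
    rw [h2, Fintype.card_sum, Fintype.card_fin]
    ring
  let f : OrthonormalBasis (Fin n ⊕ Fin n) ℝ (TangentSpace 𝓘(ℝ, E) x) :=
    OrthonormalBasis.mk hon
      (hon.linearIndependent.span_eq_top_of_card_eq_finrank' hcard).ge
  have hf : ⇑f = Sum.elim u fun i ↦ S.J x (u i) := OrthonormalBasis.coe_mk _ _
  -- The vectors `u_j` and `J u_j` contribute equally to the real trace; this is the source of the
  -- `1/2` in the statement.
  have htr : ∑ i, ⟪B (e i), S.J x (e i)⟫ = 2 * ∑ j, ⟪B (u j), S.J x (u j)⟫ := by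
    rw [S.sum_inner_J_eq_trace e, ← S.sum_inner_J_eq_trace f]
    simp only [hf, Fintype.sum_sum_type, Sum.elim_inl, Sum.elim_inr, hBJ, S.inner_J_J]
    ring
  rw [htr]
  have hj : ∀ j, S.Ψ x (Function.update u j (B (u j))) =
      Complex.I * (⟪B (u j), S.J x (u j)⟫ : ℝ) * S.Ψ x u := by
    intro j
    let L := (S.Ψ x).toMultilinearMap.toLinearMap u j
    have hL : ∀ v, L v = S.Ψ x (Function.update u j v) := fun v ↦ rfl
    have hLu : ∀ k, L (u k) = if k = j then S.Ψ x u else 0 := fun k ↦ by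
      rw [hL]
      split_ifs with hk
      · rw [hk, Function.update_eq_self]
      · exact (S.Ψ x).map_eq_zero_of_eq _ (by simp [hk]) hk
    have hLJ : ∀ k, L (S.J x (u k)) = Complex.I * L (u k) := fun k ↦ by
      rw [hL, hL]
      have h := S.Ψ_J x (Function.update u j (u k)) j
      rwa [Function.update_idem, Function.update_self] at h
    -- Expand `B u_j` in the basis `u_k, J u_k`. Alternation keeps only `k = j`, skewness kills the
    -- `u_j` coefficient, and `J u_j` brings out a factor `i`.
    have hsum := congrArg L (f.sum_repr' (B (u j)))
    rw [map_sum] at hsum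
    rw [← hL, ← hsum]
    simp only [map_smul, hf, Fintype.sum_sum_type, Sum.elim_inl, Sum.elim_inr, hLJ, hLu,
      mul_ite, mul_zero, smul_ite, smul_zero, Finset.sum_ite_eq', Finset.mem_univ, if_true]
    have h0 : ⟪u j, B (u j)⟫ = (0 : ℝ) := by
      linarith [hB (u j) (u j), real_inner_comm (u j) (B (u j))]
    rw [h0, zero_smul, zero_add, real_inner_comm, Complex.real_smul]
    ring
  simp only [hj, ← Finset.sum_mul, ← Finset.mul_sum]
  push_cast
  ring

end SpecialStructure

/-! ### Consequences of `Ψ` being parallel: smoothness of `η̂` and the curvature of `D`. -/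

namespace SpecialStructure

variable {n : ℕ} {S : SpecialStructure E M n} {D : Connection E M}
  {X Y Z W : Π x : M, TangentSpace 𝓘(ℝ, E) x} {x : M} {U : Fin n → Π x : M, TangentSpace 𝓘(ℝ, E) x}

theorem smoothFunNear_Ψ (hU : ∀ i, SmoothNear (U i) x) :
    SmoothFunNear (E := E) (fun y ↦ S.Ψ y (fun i ↦ U i y)) x := by
  filter_upwards [eventually_all.2 hU] with y h using S.smooth_Ψ y U h

theorem update_field_apply (U : Fin n → Π x : M, TangentSpace 𝓘(ℝ, E) x) (i : Fin n)
    (V : Π x : M, TangentSpace 𝓘(ℝ, E) x) (y : M) :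
    (fun k ↦ Function.update U i V k y) = Function.update (fun k ↦ U k y) i (V y) := by
  funext k
  by_cases h : k = i
  · subst h
    simp
  · simp [h]

theorem smoothNear_update (hU : ∀ i, SmoothNear (U i) x) (hX : SmoothNear X x) (i k : Fin n) :
    SmoothNear (Function.update U i X k) x := by
  by_cases h : k = i
  · subst h
    simpa using hX
  · simpa [h] using hU k

theorem smoothFunNear_Ψ_update (hU : ∀ i, SmoothNear (U i) x) (hX : SmoothNear X x) (i : Fin n) :
    SmoothFunNear (E := E) (fun y ↦ S.Ψ y (Function.update (fun k ↦ U k y) i (X y))) x := by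
  simpa only [update_field_apply] using smoothFunNear_Ψ (S := S) (smoothNear_update hU hX i)

/-- The double sum collects the terms in which two different slots are differentiated once each;
separating it lets it cancel in the commutator. -/
theorem IsMinimalSUConnection.mvfderiv_mvfderiv_Ψ (hD : S.IsMinimalSUConnection D)
    (hU : ∀ i, SmoothNear (U i) x) (hDY : ∀ i, SmoothNear (fun y ↦ D (U i) y (Y y)) x) :
    d% (fun y ↦ d% (fun z ↦ S.Ψ z (fun i ↦ U i z)) y (Y y)) x (X x) =
      ∑ i, S.Ψ x (Function.update (fun k ↦ U k x) i
        (D (fun y ↦ D (U i) y (Y y)) x (X x))) +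
      ∑ i, ∑ j, if j = i then 0 else
        S.Ψ x (Function.update (Function.update (fun k ↦ U k x) i (D (U i) x (Y x))) j
          (D (U j) x (X x))) := by
  have e : ∀ᶠ y in 𝓝 x, d% (fun z ↦ S.Ψ z (fun i ↦ U i z)) y (Y y) =
      ∑ i, S.Ψ y (Function.update (fun k ↦ U k y) i (D (U i) y (Y y))) := by
    filter_upwards [eventually_all.2 hU] with y h
    exact hD.parallel_Ψ y U (fun i ↦ (h i).mdifferentiableAt (by simp)) _
  rw [mvfderiv_congr e, mvfderiv_fun_sum fun i _ ↦ smoothFunNear_Ψ_update hU (hDY i) i,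
    ← Finset.sum_add_distrib]
  refine Finset.sum_congr rfl fun i _ ↦ ?_
  have h := hD.parallel_Ψ x (Function.update U i fun y ↦ D (U i) y (Y y))
    (fun k ↦ (smoothNear_update hU (hDY i) i k).mdifferentiableAt) (X x)
  simp only [update_field_apply] at h
  have hs : ∀ A : ℂ, A = ∑ j, if j = i then A else 0 := fun A ↦ by simp
  rw [h, hs (S.Ψ x (Function.update (fun k ↦ U k x) i _)), ← Finset.sum_add_distrib]
  refine Finset.sum_congr rfl fun j _ ↦ ?_
  by_cases hji : j = i
  · subst hji
    simp
  · simp [hji]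

/-- The curvature of a connection for which `Ψ` is parallel has vanishing complex trace. -/
theorem IsMinimalSUConnection.sum_Ψ_curvatureOf [Nontrivial E] (hD : S.IsMinimalSUConnection D)
    (hX : SmoothNear X x) (hY : SmoothNear Y x) (hU : ∀ i, SmoothNear (U i) x)
    (hDX : ∀ i, SmoothNear (fun y ↦ D (U i) y (X y)) x)
    (hDY : ∀ i, SmoothNear (fun y ↦ D (U i) y (Y y)) x) :
    ∑ i, S.Ψ x (Function.update (fun k ↦ U k x) i (curvatureOf D X Y (U i) x)) = 0 := by
  have h := mvfderiv_mlieBracket_complex (smoothFunNear_Ψ (S := S) hU) hX hY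
  rw [hD.mvfderiv_mvfderiv_Ψ hU hDY, hD.mvfderiv_mvfderiv_Ψ hU hDX,
    hD.parallel_Ψ x U fun i ↦ (hU i).mdifferentiableAt] at h
  -- Exchanging the slots `i` and `j` shows that the mixed terms are symmetric in `X` and `Y`.
  have hsymm : (∑ i, ∑ j, if j = i then 0 else
        S.Ψ x (Function.update (Function.update (fun k ↦ U k x) i (D (U i) x (Y x))) j
          (D (U j) x (X x)))) = ∑ i, ∑ j, if j = i then 0 else
        S.Ψ x (Function.update (Function.update (fun k ↦ U k x) i (D (U i) x (X x))) j
          (D (U j) x (Y x))) := by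
    rw [Finset.sum_comm]
    refine Finset.sum_congr rfl fun j _ ↦ Finset.sum_congr rfl fun i _ ↦ ?_
    by_cases hij : i = j
    · simp [hij]
    · rw [if_neg hij, if_neg (Ne.symm hij), Function.update_comm hij]
  rw [hsymm] at h
  have hadd : ∀ i, S.Ψ x (Function.update (fun k ↦ U k x) i (curvatureOf D X Y (U i) x)) =
      S.Ψ x (Function.update (fun k ↦ U k x) i (D (U i) x (mlieBracket 𝓘(ℝ, E) X Y x)))
      - S.Ψ x (Function.update (fun k ↦ U k x) i (D (fun y ↦ D (U i) y (Y y)) x (X x)))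
      + S.Ψ x (Function.update (fun k ↦ U k x) i (D (fun y ↦ D (U i) y (X y)) x (Y x))) := by
    intro i
    let L := (S.Ψ x).toMultilinearMap.toLinearMap (fun k ↦ U k x) i
    change L (curvatureOf D X Y (U i) x) = L _ - L _ + L _
    rw [curvatureOf, map_add, map_sub]
  simp only [hadd, Finset.sum_add_distrib, Finset.sum_sub_distrib]
  rw [h]
  ring

/-! ### The one-form `η̂` -/


theorem Ψ_update_smul_J (u : Fin n → TangentSpace 𝓘(ℝ, E) x) (i : Fin n) (c : ℝ) :
    S.Ψ x (Function.update u i (c • S.J x (u i))) = c * Complex.I * S.Ψ x u := by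
  rw [ContinuousAlternatingMap.map_update_smul, S.Ψ_J, Complex.real_smul, mul_assoc]

theorem IsMinimalSUConnection.connection_eq (hD : S.IsMinimalSUConnection D) (hn : n ≠ 0)
    (hE : Module.finrank ℝ E = 2 * n) (hZ : MDiffAt (T% Z) x) (v : TangentSpace 𝓘(ℝ, E) x) :
    D Z x v = S.minimalUConnection Z x v + S.etaHat D x v • S.J x (Z x) := by
  rw [S.connection_eq_add_eta hZ, hD.eta_eq hn hE]

/-- With `f = Ψ(U)`, parallelism gives `df(X) - ∑ Ψ(…, ∇ᵁ_X U_i, …) = n i η̂(X) f`. The left side is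
smooth and `f` is nonzero near `x`, so `η̂(X)` is a smooth quotient. -/
theorem IsMinimalSUConnection.smoothFunNear_etaHat [Nontrivial E] (hD : S.IsMinimalSUConnection D)
    (hn : n ≠ 0) (hE : Module.finrank ℝ E = 2 * n) (hX : SmoothNear X x) :
    SmoothFunNear (E := E) (fun y ↦ S.etaHat D y (X y)) x := by
  obtain ⟨u, hu, hJ⟩ := S.exists_unitary_system x n hE.ge
  have h0 := S.Ψ_ne_zero (S.hermitian_eq hu hJ)
  set U : Fin n → Π x : M, TangentSpace 𝓘(ℝ, E) x := fun i ↦ extend E (u i)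
  have hU : ∀ i, SmoothNear (U i) x := fun i ↦ smoothNear_extend _
  set f : M → ℂ := fun y ↦ S.Ψ y (fun i ↦ U i y)
  have hf : SmoothFunNear (E := E) f x := smoothFunNear_Ψ hU
  have hfx : f x ≠ 0 := by simpa only [f, U, extend_apply_self] using h0
  have hn' : (n : ℂ) * Complex.I ≠ 0 := mul_ne_zero (Nat.cast_ne_zero.2 hn) Complex.I_ne_zero
  have hg : SmoothFunNear (E := E) (fun y ↦ d% f y (X y) - ∑ i, S.Ψ y
      (Function.update (fun k ↦ U k y) i (S.minimalUConnection (U i) y (X y)))) x :=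
    (hf.deriv_complex hX).sub (SmoothFunNear.sum fun i _ ↦
      smoothFunNear_Ψ_update hU (S.isSmoothConnection_minimalU (hU i) hX) i)
  have hc : SmoothFunNear (E := E) (fun y ↦ (n * Complex.I) * f y) x :=
    hf.clm_comp (ContinuousLinearMap.mul ℝ ℂ (n * Complex.I))
  refine ((hg.div_complex hc (mul_ne_zero hn' hfx)).clm_comp Complex.reCLM).congr ?_
  filter_upwards [eventually_all.2 hU, hf.contMDiffAt.continuousAt.eventually_ne hfx] with y h1 h2
  have h3 := hD.parallel_Ψ y U (fun i ↦ (h1 i).mdifferentiableAt (by simp)) (X y)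
  have h4 : ∀ i, S.Ψ y (Function.update (fun k ↦ U k y) i (D (U i) y (X y))) =
      S.Ψ y (Function.update (fun k ↦ U k y) i (S.minimalUConnection (U i) y (X y)))
        + S.etaHat D y (X y) * Complex.I * f y := fun i ↦ by
    rw [hD.connection_eq hn hE ((h1 i).mdifferentiableAt (by simp)),
      ContinuousAlternatingMap.map_update_add, Ψ_update_smul_J (fun k ↦ U k y) i]
  simp only [h4, Finset.sum_add_distrib, Finset.sum_const, Finset.card_univ, Fintype.card_fin,
    nsmul_eq_mul] at h3
  change d% f y (X y) = _ at h3
  rw [h3, add_sub_cancel_left]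
  have h5 : (n : ℂ) * (S.etaHat D y (X y) * Complex.I * f y) / (n * Complex.I * f y) =
      S.etaHat D y (X y) := by
    rw [div_eq_iff (mul_ne_zero hn' h2)]
    ring
  rw [h5]
  exact Complex.ofReal_re _

theorem IsMinimalSUConnection.smoothNear_connection [Nontrivial E] (hD : S.IsMinimalSUConnection D)
    (hn : n ≠ 0) (hE : Module.finrank ℝ E = 2 * n) (hZ : SmoothNear Z x) (hX : SmoothNear X x) :
    SmoothNear (fun y ↦ D Z y (X y)) x := by
  refine ((S.isSmoothConnection_minimalU hZ hX).add
    ((S.smoothNear_J hZ).smul (hD.smoothFunNear_etaHat hn hE hX))).congr ?_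
  filter_upwards [hZ] with y h
  exact (hD.connection_eq hn hE (h.mdifferentiableAt (by simp)) _).symm

/-- In `D = ∇ᵁ + η̂ J` the summand `J` is parallel and commutes with itself, so the first-order
cross terms and the quadratic term are symmetric and cancel; only `dη̂` remains. -/
theorem IsMinimalSUConnection.curvatureOf_eq [Nontrivial E] (hD : S.IsMinimalSUConnection D)
    (hn : n ≠ 0) (hE : Module.finrank ℝ E = 2 * n) (hX : SmoothNear X x) (hY : SmoothNear Y x)
    (hZ : SmoothNear Z x) :
    curvatureOf D X Y Z x = curvatureOf S.minimalUConnection X Y Z x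
      - (d% (fun y ↦ S.etaHat D y (Y y)) x (X x) - d% (fun y ↦ S.etaHat D y (X y)) x (Y x)
          - S.etaHat D x (mlieBracket 𝓘(ℝ, E) X Y x)) • S.J x (Z x) := by
  have hs := S.isSmoothConnection_minimalU
  have key : ∀ {V W : Π x : M, TangentSpace 𝓘(ℝ, E) x}, SmoothNear V x → SmoothNear W x →
      D (fun y ↦ D Z y (W y)) x (V x) =
        S.minimalUConnection (fun y ↦ S.minimalUConnection Z y (W y)) x (V x)
        + S.etaHat D x (W x) • S.J x (S.minimalUConnection Z x (V x))
        + d% (fun y ↦ S.etaHat D y (W y)) x (V x) • S.J x (Z x)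
        + S.etaHat D x (V x) • S.J x (S.minimalUConnection Z x (W x))
        - (S.etaHat D x (V x) * S.etaHat D x (W x)) • Z x := by
    intro V W hV hW
    have hη := hD.smoothFunNear_etaHat hn hE hW
    have e : ∀ᶠ y in 𝓝 x, D Z y (W y) =
        S.minimalUConnection Z y (W y) + S.etaHat D y (W y) • S.J y (Z y) := by
      filter_upwards [hZ] with y h
      exact hD.connection_eq hn hE (h.mdifferentiableAt (by simp)) _
    rw [connection_congr (hD.smoothNear_connection hn hE hZ hW).mdifferentiableAt e,
      hD.connection_eq hn hE
        ((hs hZ hW).add ((S.smoothNear_J hZ).smul hη)).mdifferentiableAt,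
      connection_add (hs hZ hW).mdifferentiableAt ((S.smoothNear_J hZ).smul hη).mdifferentiableAt,
      connection_smul hη.mdifferentiableAt (S.smoothNear_J hZ).mdifferentiableAt]
    simp only [add_apply, smul_apply, ContinuousLinearMap.smulRight_apply, map_add, map_smul,
      S.J_J, S.minimalUConnection_J hZ.mdifferentiableAt]
    module
  rw [curvatureOf, curvatureOf, key hX hY, key hY hX, hD.connection_eq hn hE hZ.mdifferentiableAt]
  module

end SpecialStructure

/-- The curvature of the minimal `U(n)`-connection as an endomorphism. -/
def AlmostHermitian.curvatureUHom [Nontrivial E] (S : AlmostHermitian E M) (x : M)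
    (a b : TangentSpace 𝓘(ℝ, E) x) : TangentSpace 𝓘(ℝ, E) x →ₗ[ℝ] TangentSpace 𝓘(ℝ, E) x where
  toFun := S.curvatureU x a b
  map_add' v w := ext_inner_right ℝ fun u ↦ by
    simp only [inner_add_left, S.inner_curvatureU]
    ring
  map_smul' r v := ext_inner_right ℝ fun u ↦ by
    simp only [RingHom.id_apply, real_inner_smul_left, S.inner_curvatureU]
    ring

/-! ### The trace of the `U(n)`-curvature and the formula for `Ric*`. -/

namespace SpecialStructure

variable {n : ℕ} {S : SpecialStructure E M n} {D : Connection E M} {x : M}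

/-- `Rᵁ - dη̂ J` acts on `Ψ(u)` by zero. The first summand acts by `i/2` times the trace on the
left, the second by `-n i dη̂`, and `Ψ(u) ≠ 0` can be divided out. -/
theorem IsMinimalSUConnection.sum_inner_curvatureU [Nontrivial E] (hD : S.IsMinimalSUConnection D)
    (hn : n ≠ 0) (hE : Module.finrank ℝ E = 2 * n) {ι : Type*} [Fintype ι]
    (e : OrthonormalBasis ι ℝ (TangentSpace 𝓘(ℝ, E) x)) (a b : TangentSpace 𝓘(ℝ, E) x) :
    ∑ i, ⟪S.curvatureU x a b (e i), S.J x (e i)⟫ =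
      2 * (n * extDerivOneForm (S.etaHat D) x a b) := by
  obtain ⟨u, hu, hJ⟩ := S.exists_unitary_system x n hE.ge
  have h0 := S.Ψ_ne_zero (S.hermitian_eq hu hJ)
  set U : Fin n → Π x : M, TangentSpace 𝓘(ℝ, E) x := fun i ↦ extend E (u i) with hUdef
  have hU : ∀ i, SmoothNear (U i) x := fun i ↦ smoothNear_extend _
  have hUx : ∀ i, U i x = u i := fun i ↦ extend_apply_self ..
  have h1 := hD.sum_Ψ_curvatureOf (smoothNear_extend a) (smoothNear_extend b) hU
    (fun i ↦ hD.smoothNear_connection hn hE (hU i) (smoothNear_extend a))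
    (fun i ↦ hD.smoothNear_connection hn hE (hU i) (smoothNear_extend b))
  have h2 : ∀ i, curvatureOf D (extend E a) (extend E b) (U i) x =
      S.curvatureUHom x a b (u i) + (-extDerivOneForm (S.etaHat D) x a b) • S.J x (u i) := fun i ↦ by
    rw [hD.curvatureOf_eq hn hE (smoothNear_extend a) (smoothNear_extend b) (hU i), neg_smul,
      ← sub_eq_add_neg, extDerivOneForm, hUx]
    simp only [extend_apply_self]
    rfl
  simp only [h2, hUx, ContinuousAlternatingMap.map_update_add, Ψ_update_smul_J,
    Finset.sum_add_distrib, Finset.sum_const, Finset.card_univ, Fintype.card_fin,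
    nsmul_eq_mul] at h1
  rw [S.sum_Ψ_update hE hu hJ (S.curvatureUHom x a b) (S.inner_curvatureU x a b)
    (S.curvatureU_J x a b) e] at h1
  have h3 : Complex.I * S.Ψ x u ≠ 0 := mul_ne_zero Complex.I_ne_zero h0
  have h4 : (((∑ i, ⟪S.curvatureU x a b (e i), S.J x (e i)⟫ : ℝ) : ℂ) / 2
      - n * (extDerivOneForm (S.etaHat D) x a b : ℝ)) * (Complex.I * S.Ψ x u) = 0 := by
    rw [← h1]
    change _ = Complex.I / 2 * ((∑ i, ⟪S.curvatureU x a b (e i), S.J x (e i)⟫ : ℝ) : ℂ) *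
      S.Ψ x u + _
    push_cast
    ring
  have h5 := (mul_eq_zero.1 h4).resolve_right h3
  have h6 : (∑ i, ⟪S.curvatureU x a b (e i), S.J x (e i)⟫) / 2
      - n * extDerivOneForm (S.etaHat D) x a b = 0 := by exact_mod_cast h5
  linarith

theorem IsMinimalSUConnection.ricciStar_eq [Nontrivial E] (hD : S.IsMinimalSUConnection D)
    (hn : n ≠ 0) (hE : Module.finrank ℝ E = 2 * n) {ι : Type*} [Fintype ι]
    (e : OrthonormalBasis ι ℝ (TangentSpace 𝓘(ℝ, E) x)) (a b : TangentSpace 𝓘(ℝ, E) x) :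
    S.ricciStar e a b = n * extDerivOneForm (S.etaHat D) x a (S.J x b)
      - ∑ i, ⟪S.xi x a (e i), S.xi x (S.J x b) (S.J x (e i))⟫ := by
  have h := S.two_mul_ricciStar e a b
  rw [S.sum_inner_curvature_J, hD.sum_inner_curvatureU hn hE] at h
  linarith

end SpecialStructure

end SpecialAlmostHermitian

end

theorem lemma3p3 (n : ℕ) (hn : 2 ≤ n)
    (M : Type*) [TopologicalSpace M] [ChartedSpace (EuclideanSpace ℝ (Fin (2 * n))) M]
    [IsManifold 𝓘(ℝ, EuclideanSpace ℝ (Fin (2 * n))) ∞ M]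
    [RiemannianBundle
      (fun x : M ↦ TangentSpace 𝓘(ℝ, EuclideanSpace ℝ (Fin (2 * n))) x)]
    [IsContMDiffRiemannianBundle 𝓘(ℝ, EuclideanSpace ℝ (Fin (2 * n))) ∞
      (EuclideanSpace ℝ (Fin (2 * n)))
      (fun x : M ↦ TangentSpace 𝓘(ℝ, EuclideanSpace ℝ (Fin (2 * n))) x)]
    (S : SpecialAlmostHermitian.SpecialStructure (EuclideanSpace ℝ (Fin (2 * n))) M n)
    (D : CovariantDerivative 𝓘(ℝ, EuclideanSpace ℝ (Fin (2 * n)))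
      (EuclideanSpace ℝ (Fin (2 * n)))
      (fun x : M ↦ TangentSpace 𝓘(ℝ, EuclideanSpace ℝ (Fin (2 * n))) x))
    (hD : S.IsMinimalSUConnection D) (x : M)
    (e : OrthonormalBasis (Fin (2 * n)) ℝ
      (TangentSpace 𝓘(ℝ, EuclideanSpace ℝ (Fin (2 * n))) x))
    (X Y : TangentSpace 𝓘(ℝ, EuclideanSpace ℝ (Fin (2 * n))) x) :
    S.eta D x X Y = S.etaHat D x X • S.J x Y ∧
    S.ricciStar e X Y =
      n * SpecialAlmostHermitian.extDerivOneForm (S.etaHat D) x X (S.J x Y)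
        - ∑ i, inner ℝ (S.xi x X (e i)) (S.xi x (S.J x Y) (S.J x (e i))) ∧
    SpecialAlmostHermitian.ricci e X Y =
      n * SpecialAlmostHermitian.extDerivOneForm (S.etaHat D) x X (S.J x Y)
        - ∑ i, inner ℝ (S.xi x X (e i)) (S.xi x (S.J x Y) (S.J x (e i)))
        - 2 * ∑ i, inner ℝ (S.nablaXi x (e i) X Y) (e i)
        + 2 * ∑ i, inner ℝ (S.nablaXi x X (e i) Y) (e i)
        - 2 * ∑ i, inner ℝ (S.xi x (S.xi x (e i) X) Y) (e i)
        + 2 * ∑ i, inner ℝ (S.xi x (S.xi x X (e i)) Y) (e i) := by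
  have hn0 : n ≠ 0 := by omega
  have hE : Module.finrank ℝ (EuclideanSpace ℝ (Fin (2 * n))) = 2 * n := by simp
  have : Nontrivial (EuclideanSpace ℝ (Fin (2 * n))) :=
    Module.nontrivial_of_finrank_pos (R := ℝ) (by omega)
  refine ⟨hD.eta_eq hn0 hE x X Y, hD.ricciStar_eq hn0 hE e X Y, ?_⟩
  rw [S.ricci_sub_ricciStar, hD.ricciStar_eq hn0 hE]
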